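/- **Setting.** There is a set $A=\{1,\dots,n\}$ of agents, a publicly known budget $B\in\mathbb{Q}_{>0}$, a publicly known valuation $v:2^A\to\mathbb{Q}_{\ge 0}$ that is normalized ($v(\emptyset)=0$) and submodular ($v(S\cup\{i\})-v(S)\ge v(T\cup\{i\})-v(T)$ for $S\subseteq T\subseteq A$, $i\notin T$) but not necessarily monotone, and a family $\mathcal I\subseteq 2^A$ of feasible sets. The family $\mathcal I$ is of one of the following types: a *cardinality constraint*, $\mathcal I=\{S: |S|\le k\}$ for some $k\ge 0$; a *matroid constraint*, $\mathcal I$ being the family of independent sets of a matroid on $A$; or a *matching constraint*, $A$ being the edge set of a loopless (multi)graph and $\mathcal I$ the family of its matchings. Each agent $i$ has a private cost $c_i\in\mathbb{Q}_{\ge 0}$. Write $$\mathrm{opt}(\mathbf c)=\max\Big\{v(S): S\in\mathcal I,\ \sum_{i\in S}c_i\le B\Big\}.$$ A deterministic mechanism $(f,p)$ maps a vector $\mathbf b\in\mathbb{Q}_{\ge0}^A$ of declared costs to a selected set $f(\mathbf b)\subseteq A$ and to payments $p_i(\mathbf b)\in\mathbb Q$, $i\in A$. The utility of agent $i$ is $p_i(\mathbf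 b)-c_i$ if $i\in f(\mathbf b)$, and $p_i(\mathbf b)$ otherwise. The mechanism is *truthful* if declaring $c_i$ is a dominant strategy for every agent $i$; *individually rational* if $p_i(\mathbf b)\ge 0$ for all $i$ and $p_i(\mathbf b)\ge b_i$ for all $i\in f(\mathbf b)$; *budget-feasible* if $\sum_{i\in A}p_i(\mathbf b)\le B$ for every $\mathbf b$. A randomized mechanism is *universally truthful* if it is a probability distribution over deterministic truthful mechanisms. **Theorem.** There are a constant $\alpha$ and a randomized algorithm with access to $v$ through value queries and to $\mathcal I$ through membership queries, such that for every $n$, every $B$ and $v$ as above, and every $\mathcal I$ that is a cardinality, matroid or matching constraint, the following hold. 1. The algorithm uses a number of independent uniform random bits that is polynomial in $n$. For every fixed outcome of these bits, it computes a deterministic mechanism $(f,p)$ that is truthful, individually rational and budget-feasible, always selects a feasible set ($f(\mathbf b)\in\mathcal I$), and pays nothing to the agents that are not selected. In particular, it is a universally truthful, individually rational, budget-feasible mechanism. 2. For every outcome of the random bits, the computation of $f(\mathbf b)$ and $p(\mathbf b)$ takes time polynomial in $n$, the bit lengths of $B$ and of the $b_i$, and the largest bit length of a value $v(S)$. 3.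 The mechanism is an $\alpha$-approximation: $\mathrm{opt}(\mathbf c)\le\alpha\cdot\mathbb{E}[v(f(\mathbf c))]$ for every $\mathbf c\in\mathbb{Q}_{\ge0}^A$. -/

import Mathlib

open Finset BigOperators

namespace Procurement

/-! ### Valuations and combinatorial constraints -/

/-- The marginal value `v(i | S) = v(S ∪ {i}) - v(S)`. -/
def marginal {n : ℕ} (v : Finset (Fin n) → ℚ≥0) (i : Fin n) (S : Finset (Fin n)) : ℚ :=
  (v (insert i S) : ℚ) - (v S : ℚ)

/-- Submodularity (diminishing returns); monotonicity is not required. -/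
def IsSubmodular {n : ℕ} (v : Finset (Fin n) → ℚ≥0) : Prop :=
  ∀ S T : Finset (Fin n), S ⊆ T → ∀ i : Fin n, i ∉ T → marginal v i T ≤ marginal v i S

/-- Cardinality constraint: at most `k` agents may be selected. -/
def IsCardinalityConstraint {n : ℕ} (I : Set (Finset (Fin n))) : Prop :=
  ∃ k : ℕ, ∀ S : Finset (Fin n), S ∈ I ↔ S.card ≤ k

/-- Matroid constraint: the feasible sets are the independent sets of a matroid on the agents. -/
def IsMatroidConstraint {n : ℕ} (I : Set (Finset (Fin n))) : Prop :=
  ∃ M : Matroid (Fin n), M.E = Set.univ ∧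
    ∀ S : Finset (Fin n), S ∈ I ↔ M.Indep (S : Set (Fin n))

/-- Matching constraint: the agents are the edges of a loopless graph on some vertex set `V`
(parallel edges allowed), agent `i` having the two end points `ends i`, and the feasible sets are
the sets of pairwise disjoint edges. -/
def IsMatchingConstraint {n : ℕ} (I : Set (Finset (Fin n))) : Prop :=
  ∃ (V : Type) (ends : Fin n → Sym2 V), (∀ i, ¬ (ends i).IsDiag) ∧
    ∀ S : Finset (Fin n), S ∈ I ↔
      ∀ i ∈ S, ∀ j ∈ S, i ≠ j → ∀ x : V, ¬ (x ∈ ends i ∧ x ∈ ends j)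

/-- The public part of a procurement instance with agents `Fin n`: a normalized, non-negative,
submodular valuation, the feasible sets, and the positive budget. The costs are private. -/
structure Market (n : ℕ) where
  value : Finset (Fin n) → ℚ≥0
  value_empty : value ∅ = 0
  submodular : IsSubmodular value
  feasible : Set (Finset (Fin n))
  budget : ℚ≥0
  budget_pos : 0 < budget

open Classical in
/-- The optimal value: the largest value of a feasible set whose total cost is within the
budget. -/
noncomputable def Market.opt {n : ℕ} (K : Market n) (c : Fin n → ℚ≥0) : ℚ≥0 :=
  (univ.filter fun S : Finset (Fin n) => S ∈ K.feasible ∧ ∑ i ∈ S, c i ≤ K.budget).sup K.value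

/-! ### Deterministic mechanisms -/

/-- An outcome rule and a payment rule, as functions of the declared costs. -/
structure Mechanism (n : ℕ) where
  select : (Fin n → ℚ≥0) → Finset (Fin n)
  pay : (Fin n → ℚ≥0) → Fin n → ℚ

namespace Mechanism

variable {n : ℕ}

/-- Utility of agent `i` with true cost `t` when the declarations are `b`. The cost is incurred
only if the agent is selected. -/
def utility (M : Mechanism n) (i : Fin n) (t : ℚ≥0) (b : Fin n → ℚ≥0) : ℚ :=
  M.pay b i - if i ∈ M.select b then (t : ℚ) else 0

/-- Declaring the true cost is a dominant strategy for every agent. -/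
def IsTruthful (M : Mechanism n) : Prop :=
  ∀ (i : Fin n) (t : ℚ≥0) (b : Fin n → ℚ≥0),
    M.utility i t b ≤ M.utility i t (Function.update b i t)

/-- Payments are non-negative, and cover the declared costs of the selected agents. -/
def IsIndividuallyRational (M : Mechanism n) : Prop :=
  ∀ (b : Fin n → ℚ≥0) (i : Fin n), 0 ≤ M.pay b i ∧ (i ∈ M.select b → (b i : ℚ) ≤ M.pay b i)

/-- Agents that are not selected are paid nothing. -/
def PaysOnlySelected (M : Mechanism n) : Prop :=
  ∀ (b : Fin n → ℚ≥0) (i : Fin n), i ∉ M.select b → M.pay b i = 0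

/-- The total payment never exceeds the budget `B`. -/
def IsBudgetFeasible (M : Mechanism n) (B : ℚ≥0) : Prop :=
  ∀ b : Fin n → ℚ≥0, ∑ i, M.pay b i ≤ (B : ℚ)

end Mechanism

/-! ### Oracle programs with a step count

A deterministic, uniform machine model. The memory consists of arrays of rational numbers, all
cells initially `0` apart from the input. Arithmetic is charged by bit length. -/

/-- Number of bits of a rational number. -/
def bits (q : ℚ) : ℕ := Nat.size q.num.natAbs + Nat.size q.den

/-- `m a i` is the content of cell `i` of array `a`. -/
abbrev Memory := ℕ → ℕ → ℚ

/-- The memory after writing `q` into cell `i` of array `a`. -/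
def Memory.write (m : Memory) (a i : ℕ) (q : ℚ) : Memory :=
  fun a' i' => if a' = a ∧ i' = i then q else m a' i'

inductive Expr : Type
  | const (q : ℚ)
  /-- The content of a cell of array `a`; the index is rounded down to a natural number. -/
  | read (a : ℕ) (index : Expr)
  | add (e f : Expr)
  | sub (e f : Expr)
  | mul (e f : Expr)
  /-- Division, with quotient `0` when the divisor is `0`. -/
  | div (e f : Expr)
  /-- `1` if the first value is at most the second one, and `0` otherwise. -/
  | le (e f : Expr)

namespace Expr

def eval (m : Memory) : Expr → ℚ
  | const q => q
  | read a e => m a ⌊e.eval m⌋₊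
  | add e f => e.eval m + f.eval m
  | sub e f => e.eval m - f.eval m
  | mul e f => e.eval m * f.eval m
  | div e f => e.eval m / f.eval m
  | le e f => if e.eval m ≤ f.eval m then 1 else 0

/-- Every node of the expression costs one step plus the bit length of its value. -/
def cost (m : Memory) : Expr → ℕ
  | const q => 1 + bits q
  | read a e => e.cost m + 1 + bits ((read a e).eval m)
  | add e f => e.cost m + f.cost m + 1 + bits ((add e f).eval m)
  | sub e f => e.cost m + f.cost m + 1 + bits ((sub e f).eval m)
  | mul e f => e.cost m + f.cost m + 1 + bits ((mul e f).eval m)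
  | div e f => e.cost m + f.cost m + 1 + bits ((div e f).eval m)
  | le e f => e.cost m + f.cost m + 1 + bits ((le e f).eval m)

end Expr

/-- Programs. A program is a finite text that does not depend on the number of agents. -/
inductive Program : Type
  | skip
  /-- Write the value of `e` into the cell of array `a` given by `index`. -/
  | assign (a : ℕ) (index e : Expr)
  | seq (P Q : Program)
  /-- Run `P` if the value of `e` is not `0`, and `Q` otherwise. -/
  | ite (e : Expr) (P Q : Program)
  /-- Run `P` for `0, 1, …, k - 1` in cell `0` of array `x`, where `k` is the value of `e` on
  entry, rounded down to a natural number. -/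
  | loop (x : ℕ) (e : Expr) (P : Program)
  /-- Value query: store `v(S)` in cell `0` of array `a`, for the set `S` encoded in array `s`. -/
  | valueQuery (a s : ℕ)
  /-- Independence query: store in cell `0` of array `a` whether the set encoded in array `s` is
  feasible (`1`) or not (`0`). -/
  | feasibleQuery (a s : ℕ)

/-- The set encoded in array `s`: agent `i` belongs to it iff cell `i` is not `0`. -/
def decodeSet (n : ℕ) (m : Memory) (s : ℕ) : Finset (Fin n) :=
  univ.filter fun i => m s i ≠ 0

/-- Run a program with oracles `v` and `feas`. The result is the final memory and the number of
steps. A query costs one step for each agent, and one step for each bit of the answer. -/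
def Program.run {n : ℕ} (v : Finset (Fin n) → ℚ≥0) (feas : Finset (Fin n) → Bool) :
    Program → Memory → Memory × ℕ
  | skip, m => (m, 1)
  | assign a i e, m => (m.write a ⌊i.eval m⌋₊ (e.eval m), 1 + i.cost m + e.cost m)
  | seq P Q, m =>
      let r := P.run v feas m
      let r' := Q.run v feas r.1
      (r'.1, 1 + r.2 + r'.2)
  | ite e P Q, m =>
      let r := if e.eval m ≠ 0 then P.run v feas m else Q.run v feas m
      (r.1, 1 + e.cost m + r.2)
  | loop x e P, m =>
      (List.range ⌊e.eval m⌋₊).foldl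
        (fun r k =>
          let r' := P.run v feas (r.1.write x 0 (k : ℚ))
          (r'.1, r.2 + 1 + bits (k : ℚ) + r'.2))
        (m, 1 + e.cost m)
  | valueQuery a s, m =>
      let q : ℚ := (v (decodeSet n m s) : ℚ)
      (m.write a 0 q, 1 + n + bits q)
  | feasibleQuery a s, m =>
      (m.write a 0 (if feas (decodeSet n m s) then 1 else 0), 2 + n)

/-- The input: array `0` holds `n` and the budget, array `1` the declared costs, and array `2` the
random bits. -/
def inputMemory {n r : ℕ} (B : ℚ≥0) (b : Fin n → ℚ≥0) (ω : Fin r → Bool) : Memory :=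
  fun a i =>
    if a = 0 then (if i = 0 then (n : ℚ) else if i = 1 then (B : ℚ) else 0)
    else if a = 1 then (if h : i < n then (b ⟨i, h⟩ : ℚ) else 0)
    else if a = 2 then (if h : i < r then (if ω ⟨i, h⟩ then 1 else 0) else 0)
    else 0

open Classical in
/-- Final memory and number of steps of a program on market `K`, declarations `b` and random
bits `ω`. -/
noncomputable def Program.execute {n r : ℕ} (P : Program) (K : Market n) (b : Fin n → ℚ≥0)
    (ω : Fin r → Bool) : Memory × ℕ :=
  P.run K.value (fun S => decide (S ∈ K.feasible)) (inputMemory K.budget b ω)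

/-- The deterministic mechanism that a program computes once the random bits are fixed. The
selected set is read from array `3`, and the payments from array `4`. -/
noncomputable def Program.mechanism {n r : ℕ} (P : Program) (K : Market n) (ω : Fin r → Bool) :
    Mechanism n where
  select b := decodeSet n (P.execute K b ω).1 3
  pay b i := (P.execute K b ω).1 4 i

/-- Size of an input: the number of agents, the bit lengths of the budget and of the declared
costs, and the largest bit length of an answer of the value oracle. -/
def Market.size {n : ℕ} (K : Market n) (b : Fin n → ℚ≥0) : ℕ :=
  n + bits K.budget + ∑ i, bits (b i) + univ.sup fun S : Finset (Fin n) => bits (K.value S)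

end Procurement

open Procurement

namespace Procurement

/-! ### Submodular valuations -/

section Submodular

variable {n : ℕ} {v : Finset (Fin n) → ℚ≥0}

/-! A random bit chooses between two mechanisms. The first pays the whole budget to the best single
agent, which is good when some agent alone has a constant fraction of the optimum. The second splits
the agents at random: those outside `side` serve only to estimate the optimum, and those inside are
bought greedily at posted prices derived from that estimate.

The greedy procedure with target `x` grows two disjoint parts. The offer (agent, part) with the
largest feasible marginal `g` is priced `g * B / x`, and is refused if the part would exceed the
value `x`. The gains in a part telescope to its value, which is at most `x`, so the prices sum to at
most `B` (`Progress.IsValid.sum_price_le`). An agent's declaration is read only by the filter `c ≤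
B` and when its price is already fixed, and the estimate ignores it, so it faces a threshold price
(`Progress.exists_price`). This gives truthfulness and individual rationality.

For the approximation, fix a feasible affordable `O` inside `side`. Relative to part `j`, elements
of `O` blocked by feasibility are charged twice to part `j`, since a maximal feasible set has at
least half the size of any other (`IsTwoSystem`). Elements in the other part are paid for by their
gains there. Elements that found the price too low have marginals at most `c * x / B`, in total at
most `x`. Two parts are kept because `v` need not be monotone: for disjoint `S` and `T`, `v O ≤ v (S
∪ O) + v (T ∪ O)`. Hence either a part has value close to `x`, or `v O` is at most four times the
sum of the parts plus `2 * x` (`greedy_approximates`). Trying all `x` among `n` multiples of the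
best single value `m` makes the same procedure an estimator (`value_le_estimate`).

If `m` is small, a second-moment bound on an additive minorant of `v` shows that a random split
usually leaves a constant fraction of the optimum on both sides (`sum_value_greedyMechanism`).

All this is realized by a concrete program, `auction`. Its loops range over the agents, and the bit
length in each array is at most a fixed multiple of the input size, so it runs in polynomial time
(`Program.exists_run_le`). -/

theorem value_insert (v : Finset (Fin n) → ℚ≥0) (i : Fin n) (S : Finset (Fin n)) :
    (v (insert i S) : ℚ) = v S + marginal v i S := by
  simp [marginal]

theorem marginal_anti (hv : IsSubmodular v) {S T : Finset (Fin n)} (h : S ⊆ T) {i : Fin n}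
    (hi : i ∉ T) : marginal v i T ≤ marginal v i S :=
  hv S T h i hi

theorem value_union_le (hv : IsSubmodular v) (S O : Finset (Fin n)) :
    (v (S ∪ O) : ℚ) ≤ v S + ∑ o ∈ O \ S, marginal v o S := by
  induction O using Finset.induction_on with
  | empty => simp
  | insert a O ha ih =>
    by_cases haS : a ∈ S
    · rwa [union_insert, insert_eq_of_mem (mem_union_left _ haS), insert_sdiff_of_mem _ haS]
    · rw [union_insert, insert_sdiff_of_notMem _ haS, sum_insert (by simp [ha]), value_insert]
      have := marginal_anti hv (subset_union_left (s₁ := S) (s₂ := O)) (i := a) (by simp [haS, ha])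
      linarith

theorem value_union_sub_le (hv : IsSubmodular v) {S T : Finset (Fin n)} (h : S ⊆ T)
    (U : Finset (Fin n)) (hU : Disjoint U T) :
    (v (T ∪ U) : ℚ) - v T ≤ v (S ∪ U) - v S := by
  induction U using Finset.induction_on with
  | empty => simp
  | insert a U ha ih =>
    rw [disjoint_insert_left] at hU
    rw [union_insert, union_insert, value_insert, value_insert]
    have := marginal_anti hv (union_subset_union_left (t := U) h) (i := a) (by simp [hU.1, ha])
    linarith [ih hU.2]

/-- Adding `T` to `O` gains at least as much as adding it to `S ∪ O`, and the latter loses at most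
`v (S ∪ O)` because `v` is non-negative. Disjointness ensures that no part of `T` is already in `S`.
This replaces monotonicity. -/
theorem value_le_union_add_union (hv : IsSubmodular v) (O : Finset (Fin n))
    {S T : Finset (Fin n)} (h : Disjoint S T) :
    (v O : ℚ) ≤ v (S ∪ O) + v (T ∪ O) := by
  have h1 := value_union_sub_le hv (subset_union_right (s₁ := S) (s₂ := O)) (T \ (S ∪ O))
    sdiff_disjoint
  have h2 : O ∪ T \ (S ∪ O) = T ∪ O := by
    ext a
    have : a ∈ T → a ∉ S := fun h1 h2 => (Finset.disjoint_left.mp h) h2 h1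
    simp only [mem_union, mem_sdiff]
    tauto
  rw [h2] at h1
  have : (0 : ℚ) ≤ v (S ∪ O ∪ T \ (S ∪ O)) := by positivity
  linarith

theorem marginal_empty (h0 : v ∅ = 0) (i : Fin n) : marginal v i ∅ = v {i} := by
  simp [marginal, h0]

theorem value_le_sum_singleton (hv : IsSubmodular v) (h0 : v ∅ = 0) (O : Finset (Fin n)) :
    (v O : ℚ) ≤ ∑ o ∈ O, (v {o} : ℚ) := by
  have := value_union_le hv ∅ O
  simpa [h0, marginal_empty h0] using this

/-- An additive function that agrees with `v` on `O` and is below `v` on the subsets of `O`. -/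
theorem exists_additive_minorant (hv : IsSubmodular v) (h0 : v ∅ = 0) (O : Finset (Fin n)) :
    ∃ a : Fin n → ℚ, ∑ o ∈ O, a o = v O ∧ (∀ T ⊆ O, ∑ o ∈ T, a o ≤ v T) ∧
      ∀ o ∈ O, marginal v o (O.erase o) ≤ a o := by
  induction O using Finset.induction_on with
  | empty => exact ⟨0, by simp [h0], fun T hT => by simp, by simp⟩
  | insert m O hm ih =>
    obtain ⟨a, h1, h2, h3⟩ := ih
    have key : ∀ T ⊆ O, ∑ o ∈ T, Function.update a m (marginal v m O) o = ∑ o ∈ T, a o := by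
      intro T hT
      refine sum_congr rfl fun o ho => Function.update_of_ne ?_ _ _
      rintro rfl
      exact hm (hT ho)
    -- Each element gets its marginal over its predecessors, as for a vertex of the base polytope.
    refine ⟨Function.update a m (marginal v m O), ?_, ?_, ?_⟩
    · rw [sum_insert hm, key O subset_rfl, h1, value_insert, Function.update_self, add_comm]
    · intro T hT
      by_cases hmT : m ∈ T
      · have hT' : T.erase m ⊆ O := by
          intro o ho
          have := hT (mem_of_mem_erase ho)
          exact (mem_insert.mp this).resolve_left (ne_of_mem_erase ho)
        rw [← insert_erase hmT, sum_insert (notMem_erase _ _), key _ hT', value_insert,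
          Function.update_self]
        have := marginal_anti hv hT' hm
        linarith [h2 _ hT']
      · have hT' : T ⊆ O := (subset_insert_iff_of_notMem hmT).mp hT
        rw [key T hT']
        exact h2 T hT'
    · intro o ho
      rcases eq_or_ne o m with rfl | hne
      · rw [erase_insert hm, Function.update_self]
      · have hoO := (mem_insert.mp ho).resolve_left hne
        rw [Function.update_of_ne hne]
        refine le_trans (marginal_anti hv (erase_subset_erase _ (subset_insert _ _)) ?_) (h3 o hoO)
        simp

end Submodular

/-! ### Feasible sets -/

/-- Independence systems in which a maximal feasible subset of a set has at least half the size of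
every other feasible subset. -/
structure IsTwoSystem {n : ℕ} (feas : Finset (Fin n) → Bool) : Prop where
  empty : feas ∅
  mono : ∀ {S T : Finset (Fin n)}, S ⊆ T → feas T → feas S
  card_le : ∀ {S C : Finset (Fin n)}, feas S → feas C →
    (∀ o ∈ C, o ∉ S ∧ ¬ feas (insert o S)) → C.card ≤ 2 * S.card

open Classical in
-- For cardinality and matroid constraints the blocked set is no larger than `S`, by augmentation.
-- The factor two comes from matchings, where each edge of `S` has two end points through which it
-- can block.
theorem isTwoSystem_of_constraint {n : ℕ} {I : Set (Finset (Fin n))}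
    (h : IsCardinalityConstraint I ∨ IsMatroidConstraint I ∨ IsMatchingConstraint I) :
    IsTwoSystem fun S => decide (S ∈ I) := by
  rcases h with ⟨k, hk⟩ | ⟨M, hE, hM⟩ | ⟨V, ends, -, hI⟩
  · refine ⟨by simp [hk], fun h hT => ?_, fun {S C} hS hC h => ?_⟩
    · simp only [hk, decide_eq_true_eq] at *
      exact (card_le_card h).trans hT
    · simp only [hk, decide_eq_true_eq] at *
      rcases C.eq_empty_or_nonempty with rfl | ⟨o, ho⟩
      · simp
      · have := h o ho
        rw [card_insert_of_notMem this.1] at this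
        omega
  · refine ⟨by simp [hM], fun h hT => ?_, fun {S C} hS hC h => ?_⟩
    · simp only [hM, decide_eq_true_eq] at *
      exact hT.subset (by exact_mod_cast h)
    · simp only [hM, decide_eq_true_eq] at *
      by_contra hlt
      have hlt' : (S : Set (Fin n)).encard < (C : Set (Fin n)).encard := by
        rw [Set.encard_coe_eq_coe_finsetCard, Set.encard_coe_eq_coe_finsetCard]
        exact_mod_cast (by omega : S.card < C.card)
      obtain ⟨e, he, hi⟩ := hS.augment hC hlt'
      refine (h e (by simpa using he.1)).2 ?_
      simpa using hi
  · refine ⟨by simp [hI], fun h hT => ?_, fun {S C} hS hC h => ?_⟩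
    · simp only [hI, decide_eq_true_eq] at *
      exact fun i hi j hj => hT i (h hi) j (h hj)
    · simp only [hI, decide_eq_true_eq] at *
      have key : ∀ o ∈ C, ∃ x : V, x ∈ ends o ∧ ∃ s ∈ S, x ∈ ends s := by
        intro o ho
        obtain ⟨hoS, hno⟩ := h o ho
        by_contra hcon
        push Not at hcon
        refine hno fun i hi j hj hij x hx => ?_
        rcases mem_insert.mp hi with rfl | hi
        · rcases mem_insert.mp hj with rfl | hj
          · exact hij rfl
          · exact hcon x hx.1 j hj hx.2
        · rcases mem_insert.mp hj with hj' | hj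
          · exact hcon x (hj' ▸ hx.2) i hi hx.1
          · exact hS i hi j hj hij x hx
      rcases C.eq_empty_or_nonempty with rfl | ⟨o₀, ho₀⟩
      · simp
      have : Nonempty V := ⟨(key o₀ ho₀).choose⟩
      choose! f hf1 hf2 using key
      -- Sending each blocked edge to an end point shared with `S` is injective because `C` is a
      -- matching.
      calc C.card ≤ (S.biUnion fun s => (ends s).toFinset).card := by
            refine card_le_card_of_injOn f (fun o ho => ?_) fun o ho o' ho' hoo => ?_
            · obtain ⟨s, hs, hx⟩ := hf2 o ho
              simp only [coe_biUnion, Set.mem_iUnion]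
              exact ⟨s, hs, by simpa using hx⟩
            · by_contra hne
              exact hC o ho o' ho' hne (f o) ⟨hf1 o ho, hoo ▸ hf1 o' ho'⟩
        _ ≤ ∑ s ∈ S, (ends s).toFinset.card := card_biUnion_le
        _ ≤ ∑ s ∈ S, 2 := sum_le_sum fun s _ => by
            rw [Sym2.card_toFinset]; split <;> simp
        _ = 2 * S.card := by simp [mul_comm]

end Procurement
namespace Procurement

/-! ### The best offer

The greedy procedure maintains a status for each agent: `0` if the agent has not been processed,
`1` or `2` if the agent has joined the corresponding part, and `3` if the agent is discarded. -/

section BestOffer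

variable {n : ℕ} (v : Finset (Fin n) → ℚ≥0) (feas : Finset (Fin n) → Bool)

def part (D : Fin n → ℕ) (j : ℕ) : Finset (Fin n) := univ.filter fun z => D z = j

def joined (D : Fin n → ℕ) (j i : ℕ) : Finset (Fin n) :=
  univ.filter fun z => D z = j ∨ (z : ℕ) = i

theorem joined_val (D : Fin n → ℕ) (j : ℕ) (i : Fin n) :
    joined D j i = insert i (part D j) := by
  ext z
  simp [joined, part, Fin.ext_iff, or_comm]

/-- The offer to let `agent` join `part`, with marginal value `gain` and resulting value
`value`. -/
structure Offer where
  gain : ℚ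
  value : ℚ
  agent : ℕ
  part : ℕ

def Offer.improve (D : Fin n → ℕ) (j i : ℕ) (o : Offer) : Offer :=
  if (∃ h : i < n, D ⟨i, h⟩ = 0) ∧ feas (joined D j i) ∧
      o.gain < (v (joined D j i) : ℚ) - v (Procurement.part D j) then
    ⟨(v (joined D j i) : ℚ) - v (Procurement.part D j), v (joined D j i), i, j⟩
  else o

/-- The scan has the order of the program's loop, so that ties are broken alike. Gain `0` means that
there is no offer: since improvements are strict, every positive gain belongs to a genuine one
(`bestOffer_isSound`). -/
def bestOffer (D : Fin n → ℕ) : ℕ → Offer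
  | 0 => ⟨0, 0, 0, 0⟩
  | k + 1 => ((bestOffer D k).improve v feas D 1 k).improve v feas D 2 k

structure Offer.IsSound (D : Fin n → ℕ) (o : Offer) (i : Fin n) : Prop where
  agent_eq : o.agent = i
  status_eq : D i = 0
  part_eq : o.part = 1 ∨ o.part = 2
  feasible : feas (insert i (Procurement.part D o.part))
  value_eq : o.value = v (insert i (Procurement.part D o.part))
  gain_eq : o.gain = marginal v i (Procurement.part D o.part)

variable {v feas}

theorem Offer.gain_le_improve (D : Fin n → ℕ) (j i : ℕ) (o : Offer) :
    o.gain ≤ (o.improve v feas D j i).gain := by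
  unfold Offer.improve
  split_ifs with h
  · exact h.2.2.le
  · rfl

theorem Offer.isSound_improve (D : Fin n → ℕ) {j : ℕ} (hj : j = 1 ∨ j = 2) (i : ℕ) (o : Offer)
    (ho : 0 < o.gain → ∃ a, o.IsSound v feas D a) :
    0 < (o.improve v feas D j i).gain → ∃ a, (o.improve v feas D j i).IsSound v feas D a := by
  unfold Offer.improve
  split_ifs with h
  · intro _
    obtain ⟨⟨hi, hD⟩, hf, -⟩ := h
    have hJ := joined_val D j ⟨i, hi⟩
    simp only at hJ
    rw [hJ] at hf ⊢
    exact ⟨⟨i, hi⟩, rfl, hD, hj, hf, rfl, rfl⟩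
  · exact ho

theorem Offer.marginal_le_improve (D : Fin n → ℕ) (j : ℕ) (i : Fin n) (o : Offer)
    (hD : D i = 0) (hf : feas (insert i (Procurement.part D j))) :
    marginal v i (Procurement.part D j) ≤ (o.improve v feas D j i).gain := by
  unfold Offer.improve
  rw [joined_val]
  split_ifs with h
  · rfl
  · by_contra hlt
    exact h ⟨⟨i.2, hD⟩, hf, not_le.mp hlt⟩

theorem bestOffer_gain_nonneg (D : Fin n → ℕ) (k : ℕ) : 0 ≤ (bestOffer v feas D k).gain := by
  induction k with
  | zero => exact le_rfl
  | succ k ih =>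
    exact ih.trans ((Offer.gain_le_improve _ _ _ _).trans (Offer.gain_le_improve _ _ _ _))

theorem bestOffer_isSound (D : Fin n → ℕ) (k : ℕ) (h : 0 < (bestOffer v feas D k).gain) :
    ∃ i, (bestOffer v feas D k).IsSound v feas D i := by
  induction k with
  | zero => exact absurd h (lt_irrefl _)
  | succ k ih =>
    exact Offer.isSound_improve D (.inr rfl) _ _ (Offer.isSound_improve D (.inl rfl) _ _ ih) h

theorem marginal_le_bestOffer (D : Fin n → ℕ) {i : Fin n} (hD : D i = 0) {j : ℕ}
    (hj : j = 1 ∨ j = 2) (hf : feas (insert i (part D j))) :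
    marginal v i (part D j) ≤ (bestOffer v feas D n).gain := by
  have key : ∀ k, (i : ℕ) < k → marginal v i (part D j) ≤ (bestOffer v feas D k).gain := by
    intro k
    induction k with
    | zero => intro h; omega
    | succ k ih =>
      intro h
      rcases Nat.lt_succ_iff_lt_or_eq.mp h with h | h
      · exact (ih h).trans
          ((Offer.gain_le_improve _ _ _ _).trans (Offer.gain_le_improve _ _ _ _))
      · subst h
        rcases hj with rfl | rfl
        · exact (Offer.marginal_le_improve D 1 i _ hD hf).trans (Offer.gain_le_improve _ _ _ _)
        · exact Offer.marginal_le_improve D 2 i _ hD hf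
  exact key n i.2

end BestOffer

/-! ### The greedy procedure -/

/-- The status of each agent, and the marginal value offered to each processed agent. -/
@[ext]
structure Progress (n : ℕ) where
  status : Fin n → ℕ
  gain : Fin n → ℚ

section Greedy

variable {n : ℕ} (v : Finset (Fin n) → ℚ≥0) (feas : Finset (Fin n) → Bool) (B x : ℚ)
  (c : Fin n → ℚ≥0)

/-- Offer the price `gain * B / x` to the agent of the best offer, unless the value would
exceed `x`. -/
def Progress.step (σ : Progress n) : Progress n :=
  let o := bestOffer v feas σ.status n
  if o.gain ≤ 0 then σ else
    { status := fun z => if (z : ℕ) = o.agent then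
        (if o.value ≤ x ∧ (c z : ℚ) * x ≤ o.gain * B then o.part else 3) else σ.status z
      gain := fun z => if (z : ℕ) = o.agent then o.gain else σ.gain z }

/-- Agents costing more than `B` lie in no affordable set. Removing them makes every remaining
singleton affordable, and conflicts with no threshold, since prices offered to accepted agents are
at most `B`. -/
def startStatus (side : Fin n → Bool) : Fin n → ℕ :=
  fun z => if (c z : ℚ) ≤ B ∧ side z then 0 else 3

def Progress.steps (k : ℕ) (σ : Progress n) : Progress n :=
  (Progress.step v feas B x c)^[k] σ

/-- `n` steps suffice, as every step that is not stationary processes a new agent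
(`greedy_exhausted`). -/
def greedy (side : Fin n → Bool) : Progress n :=
  Progress.steps v feas B x c n ⟨startStatus B c side, 0⟩

variable {v feas B x c}

theorem Progress.step_of_gain_le {σ : Progress n} (h : (bestOffer v feas σ.status n).gain ≤ 0) :
    σ.step v feas B x c = σ := by
  simp [Progress.step, h]

theorem Progress.step_of_isSound {σ : Progress n} {i : Fin n}
    (h : 0 < (bestOffer v feas σ.status n).gain)
    (hi : (bestOffer v feas σ.status n).IsSound v feas σ.status i) :
    σ.step v feas B x c =
      ⟨Function.update σ.status i
        (if (bestOffer v feas σ.status n).value ≤ x ∧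
          (c i : ℚ) * x ≤ (bestOffer v feas σ.status n).gain * B
          then (bestOffer v feas σ.status n).part else 3),
        Function.update σ.gain i (bestOffer v feas σ.status n).gain⟩ := by
  unfold Progress.step
  simp only [not_le.mpr h, if_false, hi.agent_eq]
  ext z
  · rcases eq_or_ne z i with rfl | hz
    · simp
    · simp [hz, Fin.val_inj]
  · rcases eq_or_ne z i with rfl | hz
    · simp
    · simp [hz, Fin.val_inj]

theorem mem_part {D : Fin n → ℕ} {j : ℕ} {i : Fin n} : i ∈ part D j ↔ D i = j := by
  simp [part]

theorem part_update_self {D : Fin n → ℕ} {i : Fin n} {j : ℕ} :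
    part (Function.update D i j) j = insert i (part D j) := by
  ext z
  rcases eq_or_ne z i with rfl | hz
  · simp [mem_part]
  · simp [mem_part, hz]

theorem part_update_of_ne {D : Fin n → ℕ} {i : Fin n} {j k : ℕ} (h : D i ≠ k) (hj : j ≠ k) :
    part (Function.update D i j) k = part D k := by
  ext z
  rcases eq_or_ne z i with rfl | hz
  · simp [mem_part, h, hj]
  · simp [mem_part, hz]

/-- An induction principle for the steps of the greedy procedure. -/
theorem Progress.step_induction {σ : Progress n} {motive : Progress n → Prop}
    (stay : (bestOffer v feas σ.status n).gain ≤ 0 → motive σ)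
    (accept : ∀ (i : Fin n) (j : ℕ) (g : ℚ), 0 < g → g = marginal v i (part σ.status j) →
      (∀ a, σ.status a = 0 → ∀ k, k = 1 ∨ k = 2 → feas (insert a (part σ.status k)) →
        marginal v a (part σ.status k) ≤ g) →
      σ.status i = 0 → (j = 1 ∨ j = 2) → feas (insert i (part σ.status j)) →
      (v (insert i (part σ.status j)) : ℚ) ≤ x → (c i : ℚ) * x ≤ g * B →
      motive ⟨Function.update σ.status i j, Function.update σ.gain i g⟩)
    (reject : ∀ (i : Fin n) (j : ℕ) (g : ℚ), 0 < g → g = marginal v i (part σ.status j) →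
      (∀ a, σ.status a = 0 → ∀ k, k = 1 ∨ k = 2 → feas (insert a (part σ.status k)) →
        marginal v a (part σ.status k) ≤ g) →
      σ.status i = 0 → (j = 1 ∨ j = 2) → feas (insert i (part σ.status j)) →
      (x < (v (insert i (part σ.status j)) : ℚ) ∨ g * B < (c i : ℚ) * x) →
      motive ⟨Function.update σ.status i 3, Function.update σ.gain i g⟩) :
    motive (σ.step v feas B x c) := by
  rcases le_or_gt (bestOffer v feas σ.status n).gain 0 with h | h
  · rw [Progress.step_of_gain_le h]
    exact stay h
  · obtain ⟨i, hi⟩ := bestOffer_isSound _ _ h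
    rw [Progress.step_of_isSound h hi]
    split_ifs with hacc
    · exact accept i _ _ h hi.gain_eq (fun a ha k hk hf => marginal_le_bestOffer _ ha hk hf)
        hi.status_eq hi.part_eq hi.feasible (hi.value_eq ▸ hacc.1) hacc.2
    · refine reject i _ _ h hi.gain_eq (fun a ha k hk hf => marginal_le_bestOffer _ ha hk hf)
        hi.status_eq hi.part_eq hi.feasible ?_
      rw [not_and_or, not_le, not_le, hi.value_eq] at hacc
      exact hacc

theorem Progress.steps_succ (k : ℕ) (σ : Progress n) :
    σ.steps v feas B x c (k + 1) = (σ.steps v feas B x c k).step v feas B x c :=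
  Function.iterate_succ_apply' _ _ _

theorem Progress.steps_induction {motive : Progress n → Prop} {σ : Progress n} (h0 : motive σ)
    (hs : ∀ τ, motive τ → motive (τ.step v feas B x c)) (k : ℕ) :
    motive (σ.steps v feas B x c k) := by
  induction k with
  | zero => exact h0
  | succ k ih => rw [Progress.steps_succ]; exact hs _ ih

/-- Properties of the two parts that hold throughout the greedy procedure. -/
structure Progress.IsValid (v : Finset (Fin n) → ℚ≥0) (feas : Finset (Fin n) → Bool) (B x : ℚ)
    (c : Fin n → ℚ≥0) (σ : Progress n) : Prop where
  feasible : ∀ j, j = 1 ∨ j = 2 → feas (part σ.status j)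
  sum_gain : ∀ j, j = 1 ∨ j = 2 → ∑ i ∈ part σ.status j, σ.gain i = v (part σ.status j)
  value_le : ∀ j, j = 1 ∨ j = 2 → part σ.status j = ∅ ∨ (v (part σ.status j) : ℚ) ≤ x ∧ 0 < x
  affordable : ∀ j, j = 1 ∨ j = 2 → ∀ i ∈ part σ.status j, (c i : ℚ) * x ≤ σ.gain i * B
  gain_pos : ∀ j, j = 1 ∨ j = 2 → ∀ i ∈ part σ.status j, 0 < σ.gain i

theorem Progress.IsValid.step {σ : Progress n} (hσ : σ.IsValid v feas B x c) :
    (σ.step v feas B x c).IsValid v feas B x c := by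
  refine Progress.step_induction (fun _ => hσ) ?_ ?_
  · intro i j g hg hgm _ hi hj hf hx hc
    have hne : ∀ k, k = 1 ∨ k = 2 → j ≠ k →
        part (Function.update σ.status i j) k = part σ.status k :=
      fun k hk hjk => part_update_of_ne (by omega) hjk
    have hgain : ∀ k, k = 1 ∨ k = 2 → ∀ a ∈ part σ.status k,
        Function.update σ.gain i g a = σ.gain a := by
      intro k hk a ha
      refine Function.update_of_ne ?_ _ _
      rintro rfl
      rw [mem_part] at ha
      omega
    have hni : i ∉ part σ.status j := by rw [mem_part]; omega
    refine ⟨?_, ?_, ?_, ?_, ?_⟩ <;> intro k hk <;> simp only <;> rcases eq_or_ne j k with rfl | hjk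
    · rwa [part_update_self]
    · rw [hne k hk hjk]; exact hσ.feasible k hk
    · rw [part_update_self, sum_insert hni, sum_congr rfl (hgain j hk), hσ.sum_gain j hk,
        value_insert, Function.update_self, hgm, add_comm]
    · rw [hne k hk hjk, sum_congr rfl (hgain k hk), hσ.sum_gain k hk]
    · rw [part_update_self]
      -- `x` is positive because it bounds a value that has just grown by `g > 0`.
      refine .inr ⟨hx, ?_⟩
      have := value_insert v i (part σ.status j)
      have : (0 : ℚ) ≤ v (part σ.status j) := by positivity
      linarith
    · rw [hne k hk hjk]; exact hσ.value_le k hk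
    · rw [part_update_self]
      intro a ha
      rcases mem_insert.mp ha with rfl | ha
      · simpa using hc
      · rw [hgain j hk a ha]; exact hσ.affordable j hk a ha
    · rw [hne k hk hjk]
      intro a ha
      rw [hgain k hk a ha]; exact hσ.affordable k hk a ha
    · rw [part_update_self]
      intro a ha
      rcases mem_insert.mp ha with rfl | ha
      · simpa using hg
      · rw [hgain j hk a ha]; exact hσ.gain_pos j hk a ha
    · rw [hne k hk hjk]
      intro a ha
      rw [hgain k hk a ha]; exact hσ.gain_pos k hk a ha
  · intro i j g hg hgm _ hi hj hf _
    have hne : ∀ k, k = 1 ∨ k = 2 →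
        part (Function.update σ.status i 3) k = part σ.status k :=
      fun k hk => part_update_of_ne (by omega) (by omega)
    have hgain : ∀ k, k = 1 ∨ k = 2 → ∀ a ∈ part σ.status k,
        Function.update σ.gain i g a = σ.gain a := by
      intro k hk a ha
      refine Function.update_of_ne ?_ _ _
      rintro rfl
      rw [mem_part] at ha
      omega
    refine ⟨?_, ?_, ?_, ?_, ?_⟩ <;> intro k hk <;> simp only [hne k hk]
    · exact hσ.feasible k hk
    · rw [sum_congr rfl (hgain k hk), hσ.sum_gain k hk]
    · exact hσ.value_le k hk
    · intro a ha
      rw [hgain k hk a ha]; exact hσ.affordable k hk a ha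
    · intro a ha
      rw [hgain k hk a ha]; exact hσ.gain_pos k hk a ha

theorem part_startStatus (side : Fin n → Bool) {j : ℕ} (hj : j = 1 ∨ j = 2) :
    part (startStatus B c side) j = ∅ := by
  ext z
  simp only [mem_part, startStatus, notMem_empty, iff_false]
  split_ifs <;> omega

theorem Progress.isValid_start (hf : feas ∅) (h0 : v ∅ = 0) (side : Fin n → Bool) :
    Progress.IsValid v feas B x c ⟨startStatus B c side, 0⟩ := by
  refine ⟨?_, ?_, ?_, ?_, ?_⟩ <;> intro k hk <;> simp [part_startStatus side hk, hf, h0]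

theorem greedy_isValid (hf : feas ∅) (h0 : v ∅ = 0) (side : Fin n → Bool) :
    (greedy v feas B x c side).IsValid v feas B x c :=
  Progress.steps_induction (Progress.isValid_start hf h0 side) (fun _ h => h.step) n

/-- Each cost is below the price `gain * B / x`, and the gains sum to a value of at most `x`. The
parts are thus affordable for any `x`, which keeps the estimate below the optimum. -/
theorem Progress.IsValid.sum_cost_le {σ : Progress n} (hσ : σ.IsValid v feas B x c) (hB : 0 ≤ B)
    {j : ℕ} (hj : j = 1 ∨ j = 2) : ∑ i ∈ part σ.status j, (c i : ℚ) ≤ B := by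
  rcases hσ.value_le j hj with h | ⟨h, hx⟩
  · simpa [h] using hB
  · have h1 : (∑ i ∈ part σ.status j, (c i : ℚ)) * x ≤ v (part σ.status j) * B := by
      rw [← hσ.sum_gain j hj, sum_mul, sum_mul]
      exact sum_le_sum (hσ.affordable j hj)
    refine le_of_mul_le_mul_right (h1.trans ?_) hx
    rw [mul_comm B x]
    exact mul_le_mul_of_nonneg_right h hB

theorem Progress.IsValid.sum_price_le {σ : Progress n} (hσ : σ.IsValid v feas B x c) (hB : 0 ≤ B)
    {j : ℕ} (hj : j = 1 ∨ j = 2) : ∑ i ∈ part σ.status j, σ.gain i * B / x ≤ B := by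
  rcases hσ.value_le j hj with h | ⟨h, hx⟩
  · simpa [h] using hB
  · rw [← sum_div, ← sum_mul, hσ.sum_gain j hj, div_le_iff₀ hx, mul_comm B x]
    exact mul_le_mul_of_nonneg_right h hB

end Greedy

end Procurement
namespace Procurement

/-! ### Approximation by the greedy procedure -/

section GreedyApproximation

variable {n : ℕ} {v : Finset (Fin n) → ℚ≥0} {feas : Finset (Fin n) → Bool} {B x : ℚ}
  {c : Fin n → ℚ≥0}

/-- The elements of `O` are accounted for, with respect to part `j`, when the last offer had
marginal value `g`: the elements of `C` were blocked before they were processed, and their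
marginal values are charged twofold to the elements of part `j`. -/
structure Progress.IsCharged (v : Finset (Fin n) → ℚ≥0) (feas : Finset (Fin n) → Bool)
    (O : Finset (Fin n)) (σ : Progress n) (g : ℚ) (j : ℕ) (C : Finset (Fin n)) : Prop where
  subset : C ⊆ O
  blocked : ∀ o ∈ C, o ∉ part σ.status j ∧ ¬ feas (insert o (part σ.status j))
  processed : ∀ o ∈ O, o ∉ C → o ∉ part σ.status j → σ.status o ≠ 0 →
    marginal v o (part σ.status j) ≤ σ.gain o
  pending : ∀ o ∈ O, o ∉ C → σ.status o = 0 → feas (insert o (part σ.status j))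
  charge : ∑ o ∈ C, max 0 (marginal v o (part σ.status j)) +
    (2 * (part σ.status j).card - C.card : ℚ) * g ≤ 2 * v (part σ.status j)

/-- The coefficient `2 * |part| - |C|` of `g` is unspent credit. It is non-negative by the
two-system property, so the invariant survives a decrease of `g`. -/
theorem Progress.IsCharged.mono (hI : IsTwoSystem feas) {O : Finset (Fin n)} (hO : feas O)
    {σ : Progress n} {g g' : ℚ} {j : ℕ} {C : Finset (Fin n)} (hf : feas (part σ.status j))
    (h : σ.IsCharged v feas O g j C) (hg : g' ≤ g) : σ.IsCharged v feas O g' j C := by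
  refine ⟨h.subset, h.blocked, h.processed, h.pending, le_trans ?_ h.charge⟩
  have hc : (C.card : ℚ) ≤ 2 * (part σ.status j).card := by
    exact_mod_cast hI.card_le hf (hI.mono h.subset hO) h.blocked
  have := mul_le_mul_of_nonneg_left hg (sub_nonneg.mpr hc)
  linarith

/-- Processing agent `i` without adding it to part `j`. -/
theorem Progress.IsCharged.update_of_ne {O : Finset (Fin n)}
    {σ : Progress n} {g : ℚ} {j s : ℕ} {C : Finset (Fin n)} {i : Fin n}
    (h : σ.IsCharged v feas O g j C) (hi : σ.status i = 0) (hj : j = 1 ∨ j = 2) (hs : s ≠ j)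
    (hs0 : s ≠ 0) (hb : feas (insert i (part σ.status j)) → marginal v i (part σ.status j) ≤ g) :
    Progress.IsCharged v feas O ⟨Function.update σ.status i s, Function.update σ.gain i g⟩ g j C := by
  have hp : part (Function.update σ.status i s) j = part σ.status j :=
    part_update_of_ne (by omega) hs
  refine ⟨h.subset, ?_, ?_, ?_, ?_⟩ <;> simp only [hp]
  · exact h.blocked
  · intro o ho hoC hoj hso
    rcases eq_or_ne o i with rfl | hne
    · rw [Function.update_self]
      exact hb (h.pending o ho hoC hi)
    · rw [Function.update_of_ne hne] at hso ⊢
      exact h.processed o ho hoC hoj hso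
  · intro o ho hoC hso
    rcases eq_or_ne o i with rfl | hne
    · rw [Function.update_self] at hso
      exact absurd hso hs0
    · rw [Function.update_of_ne hne] at hso
      exact h.pending o ho hoC hso
  · exact h.charge

/-- Adding agent `i` to part `j`. -/
theorem Progress.IsCharged.update_self (hv : IsSubmodular v) (hI : IsTwoSystem feas)
    {O : Finset (Fin n)} {σ : Progress n} {g : ℚ} {j : ℕ} {C : Finset (Fin n)} {i : Fin n}
    (h : σ.IsCharged v feas O g j C) (hg : 0 ≤ g) (hgm : g = marginal v i (part σ.status j))
    (hi : σ.status i = 0) (hj : j = 1 ∨ j = 2) (hfi : feas (insert i (part σ.status j)))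
    (hb : ∀ a, σ.status a = 0 → feas (insert a (part σ.status j)) →
      marginal v a (part σ.status j) ≤ g) :
    ∃ C', Progress.IsCharged v feas O
      ⟨Function.update σ.status i j, Function.update σ.gain i g⟩ g j C' := by
  -- `N` consists of the unprocessed elements of `O` that become blocked by the arrival of `i`.
  set N := O.filter fun o => o ∉ C ∧ o ≠ i ∧ σ.status o = 0 ∧
    ¬ feas (insert o (insert i (part σ.status j))) with hN
  have hiT : i ∉ part σ.status j := by rw [mem_part]; omega
  have hiC : i ∉ C := fun hC => (h.blocked i hC).2 hfi
  have hdisj : Disjoint C N := by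
    rw [Finset.disjoint_left]
    intro o hoC hoN
    exact (mem_filter.mp hoN).2.1 hoC
  have hanti : ∀ o, o ∉ insert i (part σ.status j) →
      marginal v o (insert i (part σ.status j)) ≤ marginal v o (part σ.status j) :=
    fun o ho => marginal_anti hv (subset_insert _ _) ho
  have hnotin : ∀ o ∈ C ∪ N, o ∉ insert i (part σ.status j) := by
    intro o ho
    rw [mem_insert, not_or]
    rcases mem_union.mp ho with hoC | hoN
    · exact ⟨fun h' => hiC (h' ▸ hoC), (h.blocked o hoC).1⟩
    · obtain ⟨-, -, h2, h3, -⟩ := mem_filter.mp hoN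
      refine ⟨h2, ?_⟩
      rw [mem_part]
      omega
  refine ⟨C ∪ N, union_subset h.subset (filter_subset _ _), ?_, ?_, ?_, ?_⟩ <;>
    simp only [part_update_self]
  · intro o ho
    refine ⟨hnotin o ho, ?_⟩
    rcases mem_union.mp ho with hoC | hoN
    · exact fun hf => (h.blocked o hoC).2
        (hI.mono (insert_subset_insert _ (subset_insert _ _)) hf)
    · exact (mem_filter.mp hoN).2.2.2.2
  · intro o ho hoC hoj hso
    have hne : o ≠ i := fun h' => hoj (h' ▸ mem_insert_self _ _)
    rw [Function.update_of_ne hne] at hso ⊢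
    exact (hanti o hoj).trans (h.processed o ho (fun h' => hoC (mem_union_left _ h'))
      (fun h' => hoj (mem_insert_of_mem h')) hso)
  · intro o ho hoC hso
    have hne : o ≠ i := by
      rintro rfl
      rw [Function.update_self] at hso
      omega
    rw [Function.update_of_ne hne] at hso
    by_contra hf
    rw [mem_union, not_or] at hoC
    exact hoC.2 (mem_filter.mpr ⟨ho, hoC.1, hne, hso, hf⟩)
  · rw [sum_union hdisj, card_union_of_disjoint hdisj, card_insert_of_notMem hiT, value_insert,
      ← hgm]
    have h1 : ∑ o ∈ C, max 0 (marginal v o (insert i (part σ.status j))) ≤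
        ∑ o ∈ C, max 0 (marginal v o (part σ.status j)) :=
      sum_le_sum fun o ho => max_le_max le_rfl (hanti o (hnotin o (mem_union_left _ ho)))
    have h2 : ∑ o ∈ N, max 0 (marginal v o (insert i (part σ.status j))) ≤ N.card * g := by
      rw [← nsmul_eq_mul]
      refine sum_le_card_nsmul _ _ _ fun o ho => max_le hg ?_
      obtain ⟨hoO, hoC, -, h3, -⟩ := mem_filter.mp ho
      exact (hanti o (hnotin o (mem_union_right _ ho))).trans
        (hb o h3 (h.pending o hoO hoC h3))
    have h3 := h.charge
    push_cast
    linarith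

/-- The invariant of the greedy procedure as long as no offer exceeded the value `x`. -/
structure Progress.IsAccounted (v : Finset (Fin n) → ℚ≥0) (feas : Finset (Fin n) → Bool)
    (B x : ℚ) (c : Fin n → ℚ≥0) (O : Finset (Fin n)) (σ : Progress n) (g : ℚ) : Prop where
  nonneg : 0 ≤ g
  le : ∀ a, σ.status a = 0 → ∀ k, k = 1 ∨ k = 2 → feas (insert a (part σ.status k)) →
    marginal v a (part σ.status k) ≤ g
  charged : ∀ j, j = 1 ∨ j = 2 → ∃ C, σ.IsCharged v feas O g j C
  discarded : ∀ o ∈ O, σ.status o = 3 → σ.gain o * B ≤ c o * x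
  status_le : ∀ o, σ.status o ≤ 3

theorem Progress.IsAccounted.accept (hv : IsSubmodular v) (hI : IsTwoSystem feas)
    {O : Finset (Fin n)} (hO : feas O) {σ : Progress n} {g₀ : ℚ}
    (hσ : σ.IsValid v feas B x c) (h : σ.IsAccounted v feas B x c O g₀)
    {i : Fin n} {j : ℕ} {g : ℚ} (hg : 0 < g) (hgm : g = marginal v i (part σ.status j))
    (hb : ∀ a, σ.status a = 0 → ∀ k, k = 1 ∨ k = 2 → feas (insert a (part σ.status k)) →
        marginal v a (part σ.status k) ≤ g)
    (hi : σ.status i = 0) (hj : j = 1 ∨ j = 2) (hf : feas (insert i (part σ.status j))) :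
    Progress.IsAccounted v feas B x c O
      ⟨Function.update σ.status i j, Function.update σ.gain i g⟩ g := by
  -- Offered gains never increase, since `g₀` bounds all feasible marginals of unprocessed agents.
  have hgg : g ≤ g₀ := hgm ▸ h.le i hi j hj hf
  refine ⟨hg.le, ?_, ?_, ?_, ?_⟩
  · intro a ha k hk hfa
    simp only at ha hfa ⊢
    have hai : a ≠ i := by
      rintro rfl
      rw [Function.update_self] at ha
      omega
    rw [Function.update_of_ne hai] at ha
    rcases eq_or_ne j k with rfl | hjk
    · rw [part_update_self] at hfa ⊢
      refine (marginal_anti hv (subset_insert _ _) ?_).trans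
        (hb a ha j hk (hI.mono (insert_subset_insert _ (subset_insert _ _)) hfa))
      rw [mem_insert, mem_part]
      omega
    · rw [part_update_of_ne (by omega) hjk] at hfa ⊢
      exact hb a ha k hk hfa
  · intro k hk
    obtain ⟨C, hC⟩ := h.charged k hk
    have hC := hC.mono hI hO (hσ.feasible k hk) hgg
    rcases eq_or_ne j k with rfl | hjk
    · exact hC.update_self hv hI hg.le hgm hi hj hf fun a ha hfa => hb a ha j hj hfa
    · exact ⟨C, hC.update_of_ne hi hk hjk (by omega) (hb i hi k hk)⟩
  · intro o ho hso
    simp only at hso ⊢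
    rcases eq_or_ne o i with rfl | hne
    · rw [Function.update_self] at hso
      omega
    · rw [Function.update_of_ne hne] at hso ⊢
      exact h.discarded o ho hso
  · intro o
    rcases eq_or_ne o i with rfl | hne
    · simp only [Function.update_self]
      omega
    · simpa only [Function.update_of_ne hne] using h.status_le o

theorem Progress.IsAccounted.reject (hI : IsTwoSystem feas)
    {O : Finset (Fin n)} (hO : feas O) {σ : Progress n} {g₀ : ℚ}
    (hσ : σ.IsValid v feas B x c) (h : σ.IsAccounted v feas B x c O g₀)
    {i : Fin n} {j : ℕ} {g : ℚ} (hg : 0 < g) (hgm : g = marginal v i (part σ.status j))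
    (hb : ∀ a, σ.status a = 0 → ∀ k, k = 1 ∨ k = 2 → feas (insert a (part σ.status k)) →
        marginal v a (part σ.status k) ≤ g)
    (hi : σ.status i = 0) (hj : j = 1 ∨ j = 2) (hf : feas (insert i (part σ.status j)))
    (hx : g * B ≤ c i * x) :
    Progress.IsAccounted v feas B x c O
      ⟨Function.update σ.status i 3, Function.update σ.gain i g⟩ g := by
  have hgg : g ≤ g₀ := hgm ▸ h.le i hi j hj hf
  refine ⟨hg.le, ?_, ?_, ?_, ?_⟩
  · intro a ha k hk hfa
    simp only at ha hfa ⊢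
    have hai : a ≠ i := by
      rintro rfl
      rw [Function.update_self] at ha
      omega
    rw [Function.update_of_ne hai] at ha
    rw [part_update_of_ne (by omega) (by omega)] at hfa ⊢
    exact hb a ha k hk hfa
  · intro k hk
    obtain ⟨C, hC⟩ := h.charged k hk
    have hC := hC.mono hI hO (hσ.feasible k hk) hgg
    exact ⟨C, hC.update_of_ne hi hk (by omega) (by omega) (hb i hi k hk)⟩
  · intro o ho hso
    simp only at hso ⊢
    rcases eq_or_ne o i with rfl | hne
    · simpa using hx
    · rw [Function.update_of_ne hne] at hso ⊢
      exact h.discarded o ho hso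
  · intro o
    rcases eq_or_ne o i with rfl | hne
    · simp
    · simpa only [Function.update_of_ne hne] using h.status_le o

/-- For each part `j`, `v (part j ∪ O)` exceeds `v (part j)` by at most `2 * v (part j)` for blocked
elements, the value of the other part for elements placed there, and `x` for discarded ones. Pending
elements have marginals at most `0` at the end. Adding the bounds for both parts gives the factors
`4` and `2`. -/
theorem Progress.IsAccounted.value_le (hv : IsSubmodular v) {O : Finset (Fin n)} {σ : Progress n}
    {g : ℚ} (hB : 0 < B) (hx : 0 ≤ x) (hO : ∑ o ∈ O, (c o : ℚ) ≤ B)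
    (hI : IsTwoSystem feas) (hfO : feas O)
    (hσ : σ.IsValid v feas B x c) (h : σ.IsAccounted v feas B x c O g)
    (hend : (bestOffer v feas σ.status n).gain ≤ 0) :
    (v O : ℚ) ≤ 4 * (v (part σ.status 1) + v (part σ.status 2)) + 2 * x := by
  have key : ∀ j k, (j = 1 ∧ k = 2) ∨ (j = 2 ∧ k = 1) → (v (part σ.status j ∪ O) : ℚ) ≤
      3 * v (part σ.status j) + v (part σ.status k) + x := by
    intro j k hjk
    have hj : j = 1 ∨ j = 2 := by omega
    have hk : k = 1 ∨ k = 2 := by omega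
    obtain ⟨C, hC⟩ := h.charged j hj
    have hcharge := (hC.mono hI hfO (hσ.feasible j hj) h.nonneg).charge
    have hprice : ∀ o, (0 : ℚ) ≤ c o * x / B := fun o => by positivity
    have hpoint : ∀ o ∈ O \ part σ.status j, marginal v o (part σ.status j) ≤
        (if o ∈ C then max 0 (marginal v o (part σ.status j)) else 0) +
          (if o ∈ part σ.status k then σ.gain o else 0) + c o * x / B := by
      intro o ho
      obtain ⟨hoO, hoj⟩ := mem_sdiff.mp ho
      have hnn : (0 : ℚ) ≤ if o ∈ part σ.status k then σ.gain o else 0 := by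
        split_ifs with hok
        · exact (hσ.gain_pos k hk o hok).le
        · rfl
      have hp := hprice o
      by_cases hoC : o ∈ C
      · rw [if_pos hoC]
        linarith [le_max_right 0 (marginal v o (part σ.status j))]
      · rw [if_neg hoC]
        by_cases h0 : σ.status o = 0
        · have := marginal_le_bestOffer (v := v) (feas := feas) _ h0 hj (hC.pending o hoO hoC h0)
          linarith
        · have hm := hC.processed o hoO hoC hoj h0
          have h3 := h.status_le o
          rw [mem_part] at hoj
          by_cases hok : o ∈ part σ.status k
          · rw [if_pos hok]
            linarith
          · rw [mem_part] at hok
            have := h.discarded o hoO (by omega)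
            rw [← le_div_iff₀ hB] at this
            linarith
    have h1 : ∑ o ∈ O \ part σ.status j,
        (if o ∈ C then max 0 (marginal v o (part σ.status j)) else 0) ≤
          ∑ o ∈ C, max 0 (marginal v o (part σ.status j)) := by
      rw [← sum_filter]
      exact sum_le_sum_of_subset_of_nonneg (fun o ho => (mem_filter.mp ho).2)
        fun o _ _ => le_max_left _ _
    have h2 : ∑ o ∈ O \ part σ.status j, (if o ∈ part σ.status k then σ.gain o else 0) ≤
          v (part σ.status k) := by
      rw [← hσ.sum_gain k hk, ← sum_filter]
      exact sum_le_sum_of_subset_of_nonneg (fun o ho => (mem_filter.mp ho).2)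
        fun o ho _ => (hσ.gain_pos k hk o ho).le
    have h3 : ∑ o ∈ O \ part σ.status j, (c o * x / B : ℚ) ≤ x := by
      calc ∑ o ∈ O \ part σ.status j, (c o * x / B : ℚ) ≤ ∑ o ∈ O, (c o * x / B : ℚ) :=
            sum_le_sum_of_subset_of_nonneg sdiff_subset fun o _ _ => hprice o
        _ = (∑ o ∈ O, (c o : ℚ)) * x / B := by rw [sum_mul, sum_div]
        _ ≤ x := by
            rw [div_le_iff₀ hB, mul_comm x B]
            exact mul_le_mul_of_nonneg_right hO hx
    have h4 := sum_le_sum hpoint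
    rw [sum_add_distrib, sum_add_distrib] at h4
    have h5 := value_union_le hv (part σ.status j) O
    linarith
  have hd : Disjoint (part σ.status 1) (part σ.status 2) := by
    rw [Finset.disjoint_left]
    intro a h1 h2
    rw [mem_part] at h1 h2
    omega
  have := value_le_union_add_union hv O hd
  linarith [key 1 2 (by simp), key 2 1 (by simp)]

theorem bestOffer_gain_le_of_status_ne {D : Fin n → ℕ} (h : ∀ i, D i ≠ 0) (k : ℕ) :
    (bestOffer v feas D k).gain ≤ 0 := by
  by_contra hlt
  obtain ⟨i, hi⟩ := bestOffer_isSound D k (not_le.mp hlt)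
  exact h i hi.status_eq

/-- At `k = n` the second alternative leaves no unprocessed agent, hence no offer. -/
theorem Progress.steps_exhausted (k : ℕ) (σ : Progress n) :
    (bestOffer v feas (σ.steps v feas B x c k).status n).gain ≤ 0 ∨
      (part (σ.steps v feas B x c k).status 0).card + k ≤ n := by
  induction k with
  | zero =>
    refine .inr ?_
    have := card_le_univ (part σ.status 0)
    rw [Fintype.card_fin] at this
    exact this
  | succ k ih =>
    rw [Progress.steps_succ]
    rcases ih with h | h
    · rw [Progress.step_of_gain_le h]
      exact .inl h
    · have key : ∀ (τ : Progress n) (i : Fin n) (s : ℕ), τ.status i = 0 → s ≠ 0 →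
          (part τ.status 0).card + k ≤ n →
          (part (Function.update τ.status i s) 0).card + (k + 1) ≤ n := by
        intro τ i s hi hs hk
        have hlt : (part (Function.update τ.status i s) 0).card < (part τ.status 0).card := by
          refine card_lt_card ⟨fun a ha => ?_, fun hsub => ?_⟩
          · rw [mem_part] at ha ⊢
            rcases eq_or_ne a i with rfl | hne
            · exact hi
            · rwa [Function.update_of_ne hne] at ha
          · have := hsub (mem_part.mpr hi)
            rw [mem_part, Function.update_self] at this
            exact hs this
        omega
      refine Progress.step_induction (motive := fun τ =>
        (bestOffer v feas τ.status n).gain ≤ 0 ∨ (part τ.status 0).card + (k + 1) ≤ n)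
        (fun h' => .inl h') ?_ ?_
      · intro i j g _ _ _ hi hj _ _ _
        exact .inr (key _ i j hi (by omega) h)
      · intro i j g _ _ _ hi hj _ _
        exact .inr (key _ i 3 hi (by omega) h)

theorem greedy_exhausted (side : Fin n → Bool) :
    (bestOffer v feas (greedy v feas B x c side).status n).gain ≤ 0 := by
  rcases Progress.steps_exhausted (v := v) (feas := feas) (B := B) (x := x) (c := c) n
    ⟨startStatus B c side, 0⟩ with h | h
  · exact h
  · refine bestOffer_gain_le_of_status_ne (fun i hi => ?_) n
    have : (part (greedy v feas B x c side).status 0).card = 0 := by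
      unfold greedy
      omega
    rw [card_eq_zero] at this
    exact notMem_empty i (this ▸ mem_part.mpr hi)

/-- Unless some part has a value close to `x`, the two parts together have a value that is a
constant fraction of that of any affordable feasible set. -/
theorem greedy_approximates (hv : IsSubmodular v) (h0 : v ∅ = 0) (hI : IsTwoSystem feas)
    (hB : 0 < B) (hx : 0 ≤ x) {side : Fin n → Bool} {m : ℚ}
    (hm : ∀ i, side i → (c i : ℚ) ≤ B → feas {i} → (v {i} : ℚ) ≤ m)
    {O : Finset (Fin n)} (hfO : feas O) (hO : ∑ o ∈ O, (c o : ℚ) ≤ B) (hside : ∀ o ∈ O, side o) :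
    (x - m < v (part (greedy v feas B x c side).status 1) ∨
      x - m < v (part (greedy v feas B x c side).status 2)) ∨
    (v O : ℚ) ≤ 4 * (v (part (greedy v feas B x c side).status 1) +
      v (part (greedy v feas B x c side).status 2)) + 2 * x := by
  have halive : ∀ o ∈ O, startStatus B c side o = 0 := by
    intro o ho
    have : (c o : ℚ) ≤ B :=
      (single_le_sum (f := fun o => (c o : ℚ)) (fun i _ => NNRat.cast_nonneg _) ho).trans hO
    simp [startStatus, this, hside o ho]
  have key : (∀ i, (greedy v feas B x c side).status i = 0 → side i ∧ (c i : ℚ) ≤ B) ∧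
      (greedy v feas B x c side).IsValid v feas B x c ∧
      ((∃ j, (j = 1 ∨ j = 2) ∧ x - m < v (part (greedy v feas B x c side).status j)) ∨
        ∃ g, (greedy v feas B x c side).IsAccounted v feas B x c O g) := by
    refine Progress.steps_induction (motive := fun σ =>
      (∀ i, σ.status i = 0 → side i ∧ (c i : ℚ) ≤ B) ∧ σ.IsValid v feas B x c ∧
      ((∃ j, (j = 1 ∨ j = 2) ∧ x - m < v (part σ.status j)) ∨
        ∃ g, σ.IsAccounted v feas B x c O g)) ?_ ?_ n
    · refine ⟨?_, Progress.isValid_start hI.empty h0 side, .inr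
        ⟨max 0 (bestOffer v feas (startStatus B c side) n).gain, le_max_left _ _, ?_, ?_, ?_, ?_⟩⟩
      · intro i hi
        simp only [startStatus] at hi
        split_ifs at hi with h
        exact ⟨h.2, h.1⟩
      · exact fun a ha k hk hf => (marginal_le_bestOffer _ ha hk hf).trans (le_max_right _ _)
      · intro j hj
        refine ⟨∅, empty_subset _, by simp, ?_, ?_, ?_⟩ <;> simp only [part_startStatus side hj]
        · intro o ho _ _ hne
          exact absurd (halive o ho) hne
        · intro o ho _ _
          exact hI.mono (by simpa using ho) hfO
        · simp [h0]
      · intro o ho h3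
        simp only [halive o ho] at h3
        omega
      · intro o
        simp only [startStatus]
        split_ifs <;> omega
    · rintro σ ⟨h1, hσ, h2⟩
      have hσ' := hσ.step
      refine ⟨?_, hσ', ?_⟩
      · clear hσ'
        have hupd : ∀ (i : Fin n) (s : ℕ), s ≠ 0 → ∀ a, Function.update σ.status i s a = 0 →
            side a ∧ (c a : ℚ) ≤ B := by
          intro i s hs a ha
          rcases eq_or_ne a i with rfl | hne
          · rw [Function.update_self] at ha
            exact absurd ha hs
          · rw [Function.update_of_ne hne] at ha
            exact h1 a ha
        refine Progress.step_induction
          (motive := fun τ => ∀ i, τ.status i = 0 → side i ∧ (c i : ℚ) ≤ B) (fun _ => h1) ?_ ?_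
        · intro i j g _ _ _ hi hj _ _ _
          exact hupd i j (by omega)
        · intro i j g _ _ _ hi hj _ _
          exact hupd i 3 (by omega)
      · clear hσ'
        have hpart : ∀ (i : Fin n) (s k : ℕ), σ.status i = 0 → (k = 1 ∨ k = 2) → s ≠ k →
            part (Function.update σ.status i s) k = part σ.status k :=
          fun i s k hi hk hsk => part_update_of_ne (by omega) hsk
        refine Progress.step_induction (motive := fun τ =>
          (∃ j, (j = 1 ∨ j = 2) ∧ x - m < v (part τ.status j)) ∨
            ∃ g, τ.IsAccounted v feas B x c O g) (fun _ => h2) ?_ ?_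
        · intro i j g hg hgm hb hi hj hf hxv hc
          rcases h2 with ⟨k, hk, hlt⟩ | ⟨g₀, hacc⟩
          · refine .inl ⟨k, hk, ?_⟩
            rcases eq_or_ne j k with rfl | hjk
            · simp only [part_update_self]
              rw [value_insert]
              linarith
            · rwa [hpart i j k hi hk hjk]
          · exact .inr ⟨g, hacc.accept hv hI hfO hσ hg hgm hb hi hj hf⟩
        · intro i j g hg hgm hb hi hj hf hor
          rcases h2 with ⟨k, hk, hlt⟩ | ⟨g₀, hacc⟩
          · exact .inl ⟨k, hk, by rwa [hpart i 3 k hi hk (by omega)]⟩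
          · rcases hor with hgt | hgt
            · refine .inl ⟨j, hj, ?_⟩
              simp only
              rw [hpart i 3 j hi hj (by omega)]
              rw [value_insert] at hgt
              have hiT : i ∉ part σ.status j := by rw [mem_part]; omega
              have := marginal_anti hv (empty_subset (part σ.status j)) hiT
              rw [marginal_empty h0] at this
              have hsing : (v {i} : ℚ) ≤ m := by
                refine hm i (h1 i hi).1 (h1 i hi).2 (hI.mono ?_ hf)
                simp
              linarith
            · exact .inr ⟨g, hacc.reject hI hfO hσ hg hgm hb hi hj hf hgt.le⟩
  obtain ⟨-, hσ, ⟨j, rfl | rfl, hlt⟩ | ⟨g, hacc⟩⟩ := key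
  · exact .inl (.inl hlt)
  · exact .inl (.inr hlt)
  · exact .inr (hacc.value_le hv hB hx hO hI hfO hσ (greedy_exhausted side))

end GreedyApproximation

end Procurement
namespace Procurement

/-! ### Threshold prices -/

namespace Mechanism

variable {n : ℕ}

/-- Every agent faces a price that does not depend on its declaration, and is selected at this
price iff its declared cost does not exceed it. -/
def IsThresholdPriced (M : Mechanism n) : Prop :=
  ∀ (i : Fin n) (b : Fin n → ℚ≥0), ∃ p : ℚ, ∀ t : ℚ≥0,
    (i ∈ M.select (Function.update b i t) ↔ (t : ℚ) ≤ p) ∧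
      M.pay (Function.update b i t) i = if (t : ℚ) ≤ p then p else 0

theorem IsThresholdPriced.isTruthful {M : Mechanism n} (h : M.IsThresholdPriced) :
    M.IsTruthful := by
  intro i t b
  obtain ⟨p, hp⟩ := h i b
  have h1 := hp (b i)
  rw [Function.update_eq_self] at h1
  have h2 := hp t
  simp only [utility, h1.1, h1.2, h2.1, h2.2]
  split_ifs <;> linarith

theorem IsThresholdPriced.isIndividuallyRational {M : Mechanism n} (h : M.IsThresholdPriced) :
    M.IsIndividuallyRational := by
  intro b i
  obtain ⟨p, hp⟩ := h i b
  have h1 := hp (b i)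
  rw [Function.update_eq_self] at h1
  have : (0 : ℚ) ≤ b i := NNRat.cast_nonneg _
  rw [h1.1, h1.2]
  split_ifs with hle
  · exact ⟨this.trans hle, fun _ => hle⟩
  · exact ⟨le_rfl, fun h => absurd h hle⟩

theorem IsThresholdPriced.paysOnlySelected {M : Mechanism n} (h : M.IsThresholdPriced) :
    M.PaysOnlySelected := by
  intro b i hi
  obtain ⟨p, hp⟩ := h i b
  have h1 := hp (b i)
  rw [Function.update_eq_self] at h1
  rw [h1.2, if_neg (fun hle => hi (h1.1.mpr hle))]

end Mechanism

/-! ### The mechanisms -/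

section Mechanisms

variable {n : ℕ} (v : Finset (Fin n) → ℚ≥0) (feas : Finset (Fin n) → Bool) (B : ℚ)

/-- Pay the whole budget to the agent with the largest value. -/
def soloMechanism : Mechanism n where
  select b :=
    let o := bestOffer v feas (startStatus B b fun _ => true) n
    if o.gain ≤ 0 then ∅ else univ.filter fun z => (z : ℕ) = o.agent
  pay b i :=
    let o := bestOffer v feas (startStatus B b fun _ => true) n
    if o.gain ≤ 0 then 0 else if (i : ℕ) = o.agent then B else 0

/-- The largest value of a part, over the runs of the greedy procedure with the first `k` multiples
of the largest value of an agent. -/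
def estimateUpTo (c : Fin n → ℚ≥0) (side : Fin n → Bool) : ℕ → ℚ
  | 0 => (bestOffer v feas (startStatus B c side) n).gain
  | k + 1 =>
    let σ := greedy v feas B ((bestOffer v feas (startStatus B c side) n).gain * (k + 1)) c side
    max (max (estimateUpTo c side k) (v (part σ.status 1))) (v (part σ.status 2))

/-- `n` multiples suffice because `v O ≤ n * m` by subadditivity, with `m` the best single gain. -/
def estimate (c : Fin n → ℚ≥0) (side : Fin n → Bool) : ℚ := estimateUpTo v feas B c side n

/-- The agents outside `side` serve to estimate the optimum, and the greedy procedure is applied to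
the agents in `side`. -/
def greedyMechanism (side : Fin n → Bool) (J : ℕ) : Mechanism n where
  select b :=
    -- Dividing by `16` makes the loss `2 * x` at most an eighth of the optimum, below the quarter
    -- that a balanced `side` contains.
    part (greedy v feas B (estimate v feas B b (fun z => !side z) / 16) b side).status J
  pay b i :=
    let x := estimate v feas B b (fun z => !side z) / 16
    let σ := greedy v feas B x b side
    if σ.status i = J then σ.gain i * B / x else 0

variable {v feas B}

theorem startStatus_update_of_le {b : Fin n → ℚ≥0} {side : Fin n → Bool} {i : Fin n} {t : ℚ≥0}
    (ht : (t : ℚ) ≤ B) :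
    startStatus B (Function.update b i t) side = startStatus B (Function.update b i 0) side := by
  have hB : 0 ≤ B := le_trans (NNRat.cast_nonneg t) ht
  ext z
  rcases eq_or_ne z i with rfl | hne
  · simp [startStatus, ht, hB]
  · simp [startStatus, hne]

theorem startStatus_update_of_lt {b : Fin n → ℚ≥0} {side : Fin n → Bool} {i : Fin n} {t : ℚ≥0}
    (ht : B < (t : ℚ)) : startStatus B (Function.update b i t) side i = 3 := by
  simp [startStatus, not_le.mpr ht]

/-- The choice of the winner depends on an agent's cost only through whether it is at most `B`, so
the price is `B` or one that no cost meets. -/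
theorem soloMechanism_isThresholdPriced :
    (soloMechanism v feas B).IsThresholdPriced := by
  have hpay : ∀ b i, (soloMechanism v feas B).pay b i =
      if i ∈ (soloMechanism v feas B).select b then B else 0 := by
    intro b i
    simp only [soloMechanism]
    split_ifs <;> simp_all
  intro i b
  have hle : ∀ t : ℚ≥0, (t : ℚ) ≤ B → (i ∈ (soloMechanism v feas B).select (Function.update b i t) ↔
      i ∈ (soloMechanism v feas B).select (Function.update b i 0)) := by
    intro t ht
    simp only [soloMechanism, startStatus_update_of_le ht]
  have hlt : ∀ t : ℚ≥0, B < (t : ℚ) →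
      i ∉ (soloMechanism v feas B).select (Function.update b i t) := by
    intro t ht hi
    simp only [soloMechanism] at hi
    split_ifs at hi with hg
    · exact notMem_empty _ hi
    · obtain ⟨a, ha⟩ := bestOffer_isSound _ _ (not_le.mp hg)
      have h1 := (mem_filter.mp hi).2
      rw [ha.agent_eq, Fin.val_inj] at h1
      have h2 := ha.status_eq
      rw [← h1, startStatus_update_of_lt ht] at h2
      omega
  by_cases h0 : i ∈ (soloMechanism v feas B).select (Function.update b i 0)
  · refine ⟨B, fun t => ?_⟩
    have : i ∈ (soloMechanism v feas B).select (Function.update b i t) ↔ (t : ℚ) ≤ B :=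
      ⟨fun h => not_lt.mp fun h' => hlt t h' h, fun h => (hle t h).mpr h0⟩
    exact ⟨this, by rw [hpay]; simp only [this]⟩
  -- Costs are non-negative, so the price `-1` is never accepted.
  · refine ⟨-1, fun t => ?_⟩
    have ht : ¬ (t : ℚ) ≤ -1 := by
      have : (0 : ℚ) ≤ t := NNRat.cast_nonneg _
      linarith
    have : i ∉ (soloMechanism v feas B).select (Function.update b i t) := by
      rcases le_or_gt (t : ℚ) B with h | h
      · exact fun h' => h0 ((hle t h).mp h')
      · exact hlt t h
    exact ⟨iff_of_false this ht, by rw [hpay, if_neg this, if_neg ht]⟩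

theorem soloMechanism_select_eq {b : Fin n → ℚ≥0} :
    ((bestOffer v feas (startStatus B b fun _ => true) n).gain = 0 ∧
      (soloMechanism v feas B).select b = ∅ ∧ (soloMechanism v feas B).pay b = 0) ∨
    ∃ i, (soloMechanism v feas B).select b = {i} ∧ feas {i} ∧
      (bestOffer v feas (startStatus B b fun _ => true) n).gain = marginal v i ∅ ∧
      ∀ z, (soloMechanism v feas B).pay b z = if z = i then B else 0 := by
  rcases le_or_gt (bestOffer v feas (startStatus B b fun _ => true) n).gain 0 with h | h
  · refine .inl ⟨le_antisymm h (bestOffer_gain_nonneg _ _), ?_, ?_⟩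
    · simp [soloMechanism, h]
    · ext z
      simp [soloMechanism, h]
  · obtain ⟨i, hi⟩ := bestOffer_isSound _ _ h
    have hf := hi.feasible
    have hg := hi.gain_eq
    rw [part_startStatus _ hi.part_eq] at hf hg
    refine .inr ⟨i, ?_, hf, hg, fun z => ?_⟩
    · ext z
      simp [soloMechanism, not_le.mpr h, hi.agent_eq, Fin.val_inj]
    · simp [soloMechanism, not_le.mpr h, hi.agent_eq, Fin.val_inj]

theorem soloMechanism_feasible (hf : feas ∅) (b : Fin n → ℚ≥0) :
    feas ((soloMechanism v feas B).select b) := by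
  rcases soloMechanism_select_eq (v := v) (feas := feas) (B := B) (b := b) with
    ⟨-, h, -⟩ | ⟨i, h, hi, -⟩
  · rwa [h]
  · rwa [h]

theorem soloMechanism_isBudgetFeasible {B : ℚ≥0} :
    (soloMechanism v feas (B : ℚ)).IsBudgetFeasible B := by
  intro b
  rcases soloMechanism_select_eq (v := v) (feas := feas) (B := B) (b := b) with
    ⟨-, -, h⟩ | ⟨i, -, -, -, h⟩
  · simp [h]
  · simp [h]

theorem le_value_soloMechanism (h0 : v ∅ = 0) (b : Fin n → ℚ≥0) :
    (bestOffer v feas (startStatus B b fun _ => true) n).gain ≤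
      v ((soloMechanism v feas B).select b) := by
  rcases soloMechanism_select_eq (v := v) (feas := feas) (B := B) (b := b) with
    ⟨h, h', -⟩ | ⟨i, h, -, hg, -⟩
  · simp [h, h', h0]
  · rw [h, hg, marginal_empty h0]

theorem value_singleton_le_bestOffer (h0 : v ∅ = 0) {b : Fin n → ℚ≥0} {side : Fin n → Bool}
    {i : Fin n} (hs : side i) (hi : (b i : ℚ) ≤ B) (hf : feas {i}) :
    (v {i} : ℚ) ≤ (bestOffer v feas (startStatus B b side) n).gain := by
  have := marginal_le_bestOffer (v := v) (feas := feas) (startStatus B b side) (i := i) (j := 1)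
    (by simp [startStatus, hs, hi]) (.inl rfl) (by rwa [part_startStatus _ (.inl rfl)])
  rwa [part_startStatus _ (.inl rfl), marginal_empty h0] at this

/-! ### Dependence of the greedy procedure on the costs -/

section Dependence

variable {x : ℚ} {c : Fin n → ℚ≥0}

theorem Progress.step_of_status_ne {σ : Progress n} {i : Fin n} (hi : σ.status i ≠ 0) :
    (σ.step v feas B x c).status i = σ.status i ∧ (σ.step v feas B x c).gain i = σ.gain i := by
  refine Progress.step_induction
    (motive := fun τ => τ.status i = σ.status i ∧ τ.gain i = σ.gain i) (fun _ => ⟨rfl, rfl⟩) ?_ ?_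
  · intro a j g _ _ _ ha _ _ _ _
    have : i ≠ a := fun h => hi (h ▸ ha)
    simp [this]
  · intro a j g _ _ _ ha _ _ _
    have : i ≠ a := fun h => hi (h ▸ ha)
    simp [this]

theorem Progress.steps_of_status_ne {σ : Progress n} {i : Fin n} (hi : σ.status i ≠ 0) (k : ℕ) :
    (σ.steps v feas B x c k).status i = σ.status i ∧
      (σ.steps v feas B x c k).gain i = σ.gain i := by
  refine Progress.steps_induction
    (motive := fun τ => τ.status i = σ.status i ∧ τ.gain i = σ.gain i) ⟨rfl, rfl⟩
    (fun τ h => ?_) k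
  have := Progress.step_of_status_ne (v := v) (feas := feas) (B := B) (x := x) (c := c)
    (σ := τ) (i := i) (h.1 ▸ hi)
  exact ⟨this.1.trans h.1, this.2.trans h.2⟩

/-- A step reads only the cost of the agent that receives the offer, which is still unprocessed. -/
theorem Progress.step_congr {σ : Progress n} {c' : Fin n → ℚ≥0}
    (h : ∀ z, σ.status z = 0 → c z = c' z) :
    σ.step v feas B x c = σ.step v feas B x c' := by
  rcases le_or_gt (bestOffer v feas σ.status n).gain 0 with hg | hg
  · rw [Progress.step_of_gain_le hg, Progress.step_of_gain_le hg]
  · obtain ⟨i, hi⟩ := bestOffer_isSound _ _ hg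
    rw [Progress.step_of_isSound hg hi, Progress.step_of_isSound hg hi, h i hi.status_eq]

theorem Progress.steps_congr {σ : Progress n} {c' : Fin n → ℚ≥0}
    (h : ∀ z, σ.status z = 0 → c z = c' z) (k : ℕ) :
    σ.steps v feas B x c k = σ.steps v feas B x c' k := by
  induction k with
  | zero => rfl
  | succ k ih =>
    rw [Progress.steps_succ, Progress.steps_succ, ← ih]
    refine Progress.step_congr fun z hz => h z ?_
    by_contra hne
    rw [(Progress.steps_of_status_ne hne k).1] at hz
    exact hne hz

theorem startStatus_congr {c' : Fin n → ℚ≥0} {side : Fin n → Bool}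
    (h : ∀ z, side z → c z = c' z) : startStatus B c side = startStatus B c' side := by
  ext z
  by_cases hz : side z
  · simp [startStatus, h z hz]
  · simp [startStatus, hz]

theorem greedy_congr {c' : Fin n → ℚ≥0} {side : Fin n → Bool}
    (h : ∀ z, side z → c z = c' z) :
    greedy v feas B x c side = greedy v feas B x c' side := by
  unfold greedy
  rw [startStatus_congr h]
  refine Progress.steps_congr (fun z hz => h z ?_) n
  simp only [startStatus] at hz
  split_ifs at hz with hs
  exact hs.2

/-- Applied to the complement of `side`, this makes `x` independent of the declarations of the
agents who can be paid. -/
theorem estimate_congr {c' : Fin n → ℚ≥0} {side : Fin n → Bool}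
    (h : ∀ z, side z → c z = c' z) :
    estimate v feas B c side = estimate v feas B c' side := by
  unfold estimate
  have : ∀ k, estimateUpTo v feas B c side k = estimateUpTo v feas B c' side k := by
    intro k
    induction k with
    | zero => simp only [estimateUpTo, startStatus_congr h]
    | succ k ih => simp only [estimateUpTo, startStatus_congr h, greedy_congr h, ih]
  exact this n

/-- Until `i` receives the offer, the run does not depend on its cost `t`; afterwards its status and
gain are frozen. The induction peels off the first step, so the state varies. -/
theorem Progress.exists_price (hB : 0 ≤ B) {J : ℕ} (hJ : J = 1 ∨ J = 2) {i : Fin n} (k : ℕ)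
    {σ : Progress n} (hi : σ.status i = 0) :
    ∃ p : ℚ, p ≤ B ∧ ∀ t : ℚ≥0,
      ((σ.steps v feas B x (Function.update c i t) k).status i = J ↔ (t : ℚ) ≤ p) ∧
      ((t : ℚ) ≤ p → (σ.steps v feas B x (Function.update c i t) k).gain i * B / x = p) := by
  have hnever : ∀ t : ℚ≥0, ¬ (t : ℚ) ≤ -1 := by
    intro t ht
    have : (0 : ℚ) ≤ t := NNRat.cast_nonneg _
    linarith
  induction k generalizing σ with
  | zero =>
    refine ⟨-1, by linarith, fun t => ⟨iff_of_false ?_ (hnever t), fun h => absurd h (hnever t)⟩⟩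
    change ¬ σ.status i = J
    omega
  | succ k ih =>
    have hsucc : ∀ c, σ.steps v feas B x c (k + 1) =
        (σ.step v feas B x c).steps v feas B x c k := fun c => Function.iterate_succ_apply _ _ _
    simp only [hsucc]
    rcases le_or_gt (bestOffer v feas σ.status n).gain 0 with hg | hg
    · simp only [Progress.step_of_gain_le hg]
      exact ih hi
    · obtain ⟨a, ha⟩ := bestOffer_isSound _ _ hg
      simp only [Progress.step_of_isSound hg ha]
      rcases eq_or_ne a i with rfl | hne
      · set o := bestOffer v feas σ.status n
        have hfrozen : ∀ t : ℚ≥0, ∀ s : ℕ, s ≠ 0 → ∀ g,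
            (Progress.steps v feas B x (Function.update c a t) k
              ⟨Function.update σ.status a s, Function.update σ.gain a g⟩).status a = s ∧
            (Progress.steps v feas B x (Function.update c a t) k
              ⟨Function.update σ.status a s, Function.update σ.gain a g⟩).gain a = g := by
          intro t s hs g
          have := Progress.steps_of_status_ne (v := v) (feas := feas) (B := B) (x := x)
            (c := Function.update c a t) (i := a)
            (σ := ⟨Function.update σ.status a s, Function.update σ.gain a g⟩) (by simpa using hs) k
          simpa using this
        have hs : ∀ P : Prop, [Decidable P] → (if P then o.part else 3) ≠ 0 := by
          intro P _
          have := ha.part_eq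
          split_ifs <;> omega
        simp only [Function.update_self]
        -- Neither condition involves `t`. If one fails, `i` does not enter part `J` at any cost.
        by_cases hc : o.part = J ∧ o.value ≤ x
        · have hvg : o.gain ≤ o.value := by
            rw [ha.gain_eq, ha.value_eq]
            unfold marginal
            have : (0 : ℚ) ≤ v (part σ.status o.part) := by positivity
            linarith
          have hx : 0 < x := by linarith [hc.2]
          -- The price is at most `B` because the gain is at most the new value, which is at most
          -- `x`.
          refine ⟨o.gain * B / x, ?_, fun t => ?_⟩
          · rw [div_le_iff₀ hx, mul_comm]
            exact mul_le_mul_of_nonneg_left (by linarith [hc.2]) hB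
          · rw [(hfrozen t _ (hs _) _).1, (hfrozen t _ (hs _) _).2, le_div_iff₀ hx]
            refine ⟨?_, fun _ => rfl⟩
            by_cases ht : (t : ℚ) * x ≤ o.gain * B
            · simp [hc, ht]
            · simp only [ht, and_false, if_false, iff_false]
              omega
        · refine ⟨-1, by linarith, fun t => ⟨iff_of_false ?_ (hnever t),
            fun h => absurd h (hnever t)⟩⟩
          rw [(hfrozen t _ (hs _) _).1]
          split_ifs with h
          · exact fun h' => hc ⟨h', h.1⟩
          · omega
      · simp only [Function.update_of_ne hne]
        exact ih (by simp [hne.symm, hi])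

end Dependence

theorem greedyMechanism_isThresholdPriced (hB : 0 ≤ B) (side : Fin n → Bool) {J : ℕ}
    (hJ : J = 1 ∨ J = 2) : (greedyMechanism v feas B side J).IsThresholdPriced := by
  have hnever : ∀ t : ℚ≥0, ¬ (t : ℚ) ≤ -1 := by
    intro t ht
    have : (0 : ℚ) ≤ t := NNRat.cast_nonneg _
    linarith
  intro i b
  by_cases hi : side i
  · have hest : ∀ t, estimate v feas B (Function.update b i t) (fun z => !side z) =
        estimate v feas B b (fun z => !side z) := by
      intro t
      refine estimate_congr fun z hz => Function.update_of_ne ?_ _ _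
      rintro rfl
      simp [hi] at hz
    simp only [greedyMechanism, hest, mem_part]
    set x := estimate v feas B b (fun z => !side z) / 16
    -- All declarations up to `B` give the same starting status; declaration `0` represents them.
    -- Larger ones are discarded at the start, consistently with `p ≤ B`.
    obtain ⟨p, hpB, hp⟩ := Progress.exists_price (v := v) (feas := feas) (B := B) (x := x) (c := b)
      hB hJ (i := i) n (σ := ⟨startStatus B (Function.update b i 0) side, 0⟩)
      (by simp [startStatus, hi, hB])
    refine ⟨p, fun t => ?_⟩
    have hstat : (greedy v feas B x (Function.update b i t) side).status i = J ↔ (t : ℚ) ≤ p := by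
      rcases le_or_gt (t : ℚ) B with ht | ht
      · unfold greedy
        rw [startStatus_update_of_le ht]
        exact (hp t).1
      · refine iff_of_false ?_ (by linarith)
        unfold greedy
        rw [(Progress.steps_of_status_ne _ n).1] <;> simp only [startStatus_update_of_lt ht] <;>
          omega
    refine ⟨hstat, ?_⟩
    simp only [hstat]
    split_ifs with ht
    · have := (hp t).2 ht
      unfold greedy
      rwa [startStatus_update_of_le (ht.trans hpB)]
    · rfl
  · have h3 : ∀ x c, (greedy v feas B x c side).status i = 3 := by
      intro x c
      have : startStatus B c side i = 3 := by simp [startStatus, hi]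
      unfold greedy
      rw [(Progress.steps_of_status_ne _ n).1] <;> simp only [this]
      omega
    have h3J : 3 ≠ J := by omega
    refine ⟨-1, fun t => ?_⟩
    simp [greedyMechanism, mem_part, h3, h3J, hnever t]

theorem greedyMechanism_feasible (hf : feas ∅) (h0 : v ∅ = 0) (side : Fin n → Bool) {J : ℕ}
    (hJ : J = 1 ∨ J = 2) (b : Fin n → ℚ≥0) :
    feas ((greedyMechanism v feas B side J).select b) :=
  (greedy_isValid hf h0 side).feasible J hJ

theorem greedyMechanism_isBudgetFeasible {B : ℚ≥0} (hf : feas ∅) (h0 : v ∅ = 0)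
    (side : Fin n → Bool) {J : ℕ} (hJ : J = 1 ∨ J = 2) :
    (greedyMechanism v feas (B : ℚ) side J).IsBudgetFeasible B := by
  intro b
  have := (greedy_isValid (B := (B : ℚ)) (c := b)
    (x := estimate v feas B b (fun z => !side z) / 16) hf h0 side).sum_price_le
    (NNRat.cast_nonneg _) hJ
  simpa only [greedyMechanism, ← sum_filter, part] using this

end Mechanisms

end Procurement
namespace Procurement

/-! ### Approximation in expectation -/

section Approximation

variable {n : ℕ} {v : Finset (Fin n) → ℚ≥0} {feas : Finset (Fin n) → Bool} {B : ℚ}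
  {c : Fin n → ℚ≥0}

theorem estimateUpTo_mono (side : Fin n → Bool) {k l : ℕ} (h : k ≤ l) :
    estimateUpTo v feas B c side k ≤ estimateUpTo v feas B c side l := by
  refine monotone_nat_of_le_succ (f := estimateUpTo v feas B c side) (fun k => ?_) h
  exact (le_max_left _ _).trans (le_max_left _ _)

/-- A positive best gain is the value of a feasible affordable singleton, and every part produced by
the greedy procedure is feasible and affordable. -/
theorem estimate_le (h0 : v ∅ = 0) (hI : IsTwoSystem feas) (hB : 0 ≤ B) {V : ℚ}
    (hV : ∀ S, feas S → ∑ i ∈ S, (c i : ℚ) ≤ B → (v S : ℚ) ≤ V) (side : Fin n → Bool) :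
    estimate v feas B c side ≤ V := by
  unfold estimate
  have key : ∀ k, estimateUpTo v feas B c side k ≤ V := by
    intro k
    induction k with
    | zero =>
      simp only [estimateUpTo]
      rcases le_or_gt (bestOffer v feas (startStatus B c side) n).gain 0 with h | h
      · have := hV ∅ hI.empty (by simpa using hB)
        rw [h0] at this
        exact h.trans (by simpa using this)
      · obtain ⟨i, hi⟩ := bestOffer_isSound _ _ h
        have hf := hi.feasible
        have hg := hi.gain_eq
        have hs := hi.status_eq
        rw [part_startStatus _ hi.part_eq] at hf hg
        rw [hg, marginal_empty h0]
        refine hV {i} hf ?_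
        simp only [startStatus] at hs
        split_ifs at hs with hs'
        simpa using hs'.1
    | succ k ih =>
      have hval := greedy_isValid (v := v) (feas := feas) (B := B) (c := c)
        (x := (bestOffer v feas (startStatus B c side) n).gain * (k + 1)) hI.empty h0 side
      refine max_le (max_le ih ?_) ?_
      · exact hV _ (hval.feasible 1 (.inl rfl)) (hval.sum_cost_le hB (.inl rfl))
      · exact hV _ (hval.feasible 2 (.inr rfl)) (hval.sum_cost_le hB (.inr rfl))
  exact key n

/-- Some multiple `x` of `m` lies just below a quarter of `v O`. Then either a part exceeds `x - m`,
or the loss `2 * x` is at most half of `v O`. -/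
theorem value_le_estimate (hv : IsSubmodular v) (h0 : v ∅ = 0) (hI : IsTwoSystem feas)
    (hB : 0 < B) {side : Fin n → Bool} {O : Finset (Fin n)} (hfO : feas O)
    (hO : ∑ o ∈ O, (c o : ℚ) ≤ B) (hside : ∀ o ∈ O, side o) :
    (v O : ℚ) ≤ 16 * estimate v feas B c side := by
  set m := (bestOffer v feas (startStatus B c side) n).gain with hm
  have hm0 : 0 ≤ m := bestOffer_gain_nonneg _ _
  have hme : m ≤ estimate v feas B c side := estimateUpTo_mono side (Nat.zero_le n)
  have hsing : ∀ i, side i → (c i : ℚ) ≤ B → feas {i} → (v {i} : ℚ) ≤ m :=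
    fun i hs hi hf => value_singleton_le_bestOffer h0 hs hi hf
  rcases le_or_gt (v O : ℚ) (16 * m) with hsmall | hbig
  · linarith
  · have hOm : (v O : ℚ) ≤ n * m := by
      calc (v O : ℚ) ≤ ∑ o ∈ O, (v {o} : ℚ) := value_le_sum_singleton hv h0 O
        _ ≤ O.card • m := by
            refine sum_le_card_nsmul _ _ _ fun o ho => hsing o (hside o ho) ?_ ?_
            · exact (single_le_sum (f := fun o => (c o : ℚ))
                (fun i _ => NNRat.cast_nonneg _) ho).trans hO
            · exact hI.mono (by simpa using ho) hfO
        _ ≤ n * m := by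
            rw [nsmul_eq_mul]
            refine mul_le_mul_of_nonneg_right ?_ hm0
            exact_mod_cast (card_le_univ O).trans_eq (Fintype.card_fin n)
    have hmpos : 0 < m := by
      rcases hm0.lt_or_eq with h | h
      · exact h
      · rw [← h] at hOm hbig
        linarith
    -- With `x = m * (k + 1)`, `v O / 4 - m < x ≤ v O / 4`. As `v O > 16 * m`, `x - m` is above `v O
    -- / 8`.
    obtain ⟨k, hk⟩ : ∃ k, ⌊(v O : ℚ) / (4 * m)⌋₊ = k + 1 := by
      refine Nat.exists_eq_succ_of_ne_zero (Nat.pos_iff_ne_zero.mp (Nat.floor_pos.mpr ?_))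
      rw [le_div_iff₀ (by linarith)]
      linarith
    have hle : ((k + 1 : ℕ) : ℚ) ≤ (v O : ℚ) / (4 * m) := by
      rw [← hk]
      exact Nat.floor_le (by positivity)
    have hlt : (v O : ℚ) / (4 * m) < ((k + 1 : ℕ) : ℚ) + 1 := by
      rw [← hk]
      exact Nat.lt_floor_add_one _
    rw [le_div_iff₀ (by linarith)] at hle
    rw [div_lt_iff₀ (by linarith)] at hlt
    push_cast at hle hlt
    have hkn : k + 1 ≤ n := by
      have : ((k + 1 : ℕ) : ℚ) * m ≤ n * m := by push_cast; nlinarith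
      exact_mod_cast le_of_mul_le_mul_right this hmpos
    have hest : estimateUpTo v feas B c side (k + 1) ≤ estimate v feas B c side :=
      estimateUpTo_mono side hkn
    simp only [estimateUpTo, ← hm, max_le_iff] at hest
    have hx : 0 ≤ m * ((k : ℚ) + 1) := by positivity
    rcases greedy_approximates hv h0 hI hB hx hsing hfO hO hside with (h | h) | h
    · nlinarith [hest.1.2]
    · nlinarith [hest.2]
    · nlinarith [hest.1.2, hest.2]

/-- The second moment of a random signed sum. -/
theorem sum_sq_signed_sum (O : Finset (Fin n)) (a : Fin n → ℚ) :
    ∑ s : Fin n → Bool, (∑ o ∈ O, a o * (if s o then 1 else -1)) ^ 2 =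
      2 ^ n * ∑ o ∈ O, a o ^ 2 := by
  have hcross : ∀ i j : Fin n, i ≠ j →
      ∑ s : Fin n → Bool, (if s i then (1 : ℚ) else -1) * (if s j then 1 else -1) = 0 := by
    intro i j hij
    -- Flipping the sign of `i` is a bijection that negates the product, so the sum vanishes.
    have hinv : Function.Involutive fun s : Fin n → Bool => Function.update s i (!s i) := by
      intro s
      simp
    have := Equiv.sum_comp (hinv.toPerm _)
      fun s : Fin n → Bool => (if s i then (1 : ℚ) else -1) * (if s j then 1 else -1)
    have hneg : ∀ s : Fin n → Bool,
        (if (hinv.toPerm _ s) i then (1 : ℚ) else -1) * (if (hinv.toPerm _ s) j then 1 else -1) =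
          -((if s i then (1 : ℚ) else -1) * (if s j then 1 else -1)) := by
      intro s
      simp only [Function.Involutive.coe_toPerm, Function.update_self,
        Function.update_of_ne hij.symm]
      cases s i <;> cases s j <;> simp
    simp only [hneg, sum_neg_distrib] at this
    linarith
  calc ∑ s : Fin n → Bool, (∑ o ∈ O, a o * (if s o then 1 else -1)) ^ 2
      = ∑ i ∈ O, ∑ j ∈ O, a i * a j *
          ∑ s : Fin n → Bool, (if s i then (1 : ℚ) else -1) * (if s j then 1 else -1) := by
        simp only [sq, sum_mul_sum]
        simp only [mul_sum]
        rw [sum_comm]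
        refine sum_congr rfl fun i _ => ?_
        rw [sum_comm]
        exact sum_congr rfl fun j _ => sum_congr rfl fun s _ => by ring
    _ = ∑ i ∈ O, 2 ^ n * a i ^ 2 := by
        refine sum_congr rfl fun i hi => ?_
        rw [sum_eq_single i]
        · have : ∀ s : Fin n → Bool,
              (if s i then (1 : ℚ) else -1) * (if s i then 1 else -1) = 1 := by
            intro s
            split_ifs <;> norm_num
          simp only [this]
          simp
          ring
        · intro j _ hji
          rw [hcross i j hji.symm, mul_zero]
        · exact fun h => absurd hi h
    _ = 2 ^ n * ∑ o ∈ O, a o ^ 2 := by rw [mul_sum]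

/-- A second-moment argument: the imbalance of the split, measured by an additive minorant `a` of
`v` on `O`, has mean square `∑ a o ^ 2 ≤ m * v O`, a small fraction of `(v O) ^ 2`. Balanced splits
give the greedy procedure a constant fraction of the optimum. -/
theorem sum_value_greedyMechanism (hv : IsSubmodular v) (h0 : v ∅ = 0) (hI : IsTwoSystem feas)
    (hB : 0 < B) {O : Finset (Fin n)} (hfO : feas O) (hO : ∑ o ∈ O, (c o : ℚ) ≤ B)
    (hV : ∀ S, feas S → ∑ i ∈ S, (c i : ℚ) ≤ B → (v S : ℚ) ≤ v O)
    (hm : 2048 * (bestOffer v feas (startStatus B c fun _ => true) n).gain ≤ v O) :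
    (2 : ℚ) ^ n * v O ≤ 4096 * ∑ side : Fin n → Bool,
      ((v ((greedyMechanism v feas B side 1).select c) : ℚ) +
        v ((greedyMechanism v feas B side 2).select c)) := by
  set m := (bestOffer v feas (startStatus B c fun _ => true) n).gain
  have hVnn : (0 : ℚ) ≤ v O := by positivity
  rcases hVnn.eq_or_lt with hV0 | hVpos
  · rw [← hV0, mul_zero]
    positivity
  have hm0 : 0 ≤ m := bestOffer_gain_nonneg _ _
  have hcle : ∀ o ∈ O, (c o : ℚ) ≤ B := fun o ho =>
    (single_le_sum (f := fun o => (c o : ℚ)) (fun i _ => NNRat.cast_nonneg _) ho).trans hO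
  have hsub : ∀ T ⊆ O, feas T ∧ ∑ o ∈ T, (c o : ℚ) ≤ B := fun T hT =>
    ⟨hI.mono hT hfO, (sum_le_sum_of_subset_of_nonneg hT fun _ _ _ => NNRat.cast_nonneg _).trans hO⟩
  have hsing : ∀ i, (c i : ℚ) ≤ B → feas {i} → (v {i} : ℚ) ≤ m :=
    fun i hi hf => value_singleton_le_bestOffer (side := fun _ => true) h0 rfl hi hf
  obtain ⟨a, ha1, ha2, ha3⟩ := exists_additive_minorant hv h0 O
  -- Optimality of `O` makes the marginal of each of its elements over the others non-negative, even
  -- without monotonicity.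
  have hann : ∀ o ∈ O, 0 ≤ a o := by
    intro o ho
    refine le_trans ?_ (ha3 o ho)
    have := hV (O.erase o) (hsub _ (erase_subset _ _)).1 (hsub _ (erase_subset _ _)).2
    unfold marginal
    rw [insert_erase ho]
    linarith
  have ham : ∀ o ∈ O, a o ≤ m := by
    intro o ho
    have h1 := ha2 {o} (by simpa using ho)
    rw [sum_singleton] at h1
    exact h1.trans (hsing o (hcle o ho) (hsub {o} (by simpa using ho)).1)
  -- A pointwise form of Chebyshev's inequality: the left side is positive only if the imbalance is
  -- below `v O / 2`, and then both sides hold more than `v O / 4`.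
  have hpoint : ∀ side : Fin n → Bool,
      (v O : ℚ) ^ 2 - 4 * (∑ o ∈ O, a o * (if side o then 1 else -1)) ^ 2 ≤
        2048 * v O * ((v ((greedyMechanism v feas B side 1).select c) : ℚ) +
          v ((greedyMechanism v feas B side 2).select c)) := by
    intro side
    set X := ∑ o ∈ O.filter (fun o => side o), a o
    set Y := ∑ o ∈ O.filter (fun o => (!side o)), a o
    have hXY : X + Y = v O := by
      rw [← ha1, ← sum_filter_add_sum_filter_not O (fun o => side o)]
      simp [X, Y]
    have hdiff : ∑ o ∈ O, a o * (if side o then 1 else -1) = X - Y := by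
      rw [← sum_filter_add_sum_filter_not O (fun o => side o), sub_eq_add_neg, ← sum_neg_distrib]
      congr 1
      · refine sum_congr rfl fun o ho => ?_
        rw [if_pos (mem_filter.mp ho).2, mul_one]
      · simp only [Bool.not_eq_true, Bool.not_eq_eq_eq_not, Bool.not_true]
        refine sum_congr rfl fun o ho => ?_
        simp [(mem_filter.mp ho).2]
    have hX := ha2 _ (filter_subset (fun o => side o = true) O)
    have hY := ha2 _ (filter_subset (fun o => (!side o) = true) O)
    rw [hdiff]
    rcases le_or_gt ((v O : ℚ) ^ 2 - 4 * (X - Y) ^ 2) 0 with hle | hgt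
    · exact hle.trans (by positivity)
    have habs : |2 * (X - Y)| < v O := by
      refine abs_lt_of_sq_lt_sq ?_ hVnn
      nlinarith
    rw [abs_lt] at habs
    have hO1 := hsub _ (filter_subset (fun o => side o = true) O)
    have hO2 := hsub _ (filter_subset (fun o => (!side o) = true) O)
    have he1 := value_le_estimate hv h0 hI hB (side := fun z => !side z) hO2.1 hO2.2
      fun o ho => (mem_filter.mp ho).2
    have he2 := estimate_le h0 hI hB.le hV (fun z => !side z)
    have hg := greedy_approximates hv h0 hI hB
      (x := estimate v feas B c (fun z => !side z) / 16) (by linarith) (side := side) (m := m)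
      (fun i _ => hsing i) hO1.1 hO1.2 fun o ho => (mem_filter.mp ho).2
    simp only [greedyMechanism]
    set p := (v (part (greedy v feas B (estimate v feas B c (fun z => !side z) / 16) c side).status
      1) : ℚ)
    set q := (v (part (greedy v feas B (estimate v feas B c (fun z => !side z) / 16) c side).status
      2) : ℚ)
    have hp : 0 ≤ p := by positivity
    have hq : 0 ≤ q := by positivity
    -- Here the estimate is at least `v O / 64`, so `v O / 1024 ≤ x ≤ v O / 16`. A part above `x -
    -- m` has more than `v O / 2048`; otherwise `v O / 4 ≤ 4 * (p + q) + v O / 8`.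
    have hfin : (v O : ℚ) ≤ 2048 * (p + q) := by
      rcases hg with (h | h) | h <;> linarith
    nlinarith [sq_nonneg (X - Y)]
  have hsum := sum_le_sum fun side (_ : side ∈ (univ : Finset (Fin n → Bool))) => hpoint side
  rw [sum_sub_distrib, ← mul_sum, ← mul_sum, sum_sq_signed_sum] at hsum
  have hsq : ∑ o ∈ O, a o ^ 2 ≤ m * v O := by
    rw [← ha1, mul_sum]
    refine sum_le_sum fun o ho => ?_
    rw [sq]
    exact mul_le_mul_of_nonneg_right (ham o ho) (hann o ho)
  simp only [sum_const, card_univ, Fintype.card_fun, Fintype.card_bool, Fintype.card_fin,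
    nsmul_eq_mul, Nat.cast_pow, Nat.cast_ofNat] at hsum
  set G := ∑ side : Fin n → Bool, ((v ((greedyMechanism v feas B side 1).select c) : ℚ) +
        v ((greedyMechanism v feas B side 2).select c))
  have hpow : (0 : ℚ) < 2 ^ n := by positivity
  -- The subtracted second moment is thus at most `1 / 512` of the main term, so `4096` in place of
  -- `2048` absorbs it.
  have h1 : (2 : ℚ) ^ n * ∑ o ∈ O, a o ^ 2 ≤ 2 ^ n * (v O * v O / 2048) := by
    refine mul_le_mul_of_nonneg_left ?_ hpow.le
    nlinarith
  have h2 : (2 : ℚ) ^ n * v O * v O ≤ 4096 * G * v O := by nlinarith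
  exact le_of_mul_le_mul_right h2 hVpos

end Approximation

end Procurement
namespace Procurement

/-! ### Bit lengths -/

theorem one_le_bits (q : ℚ) : 1 ≤ bits q := by
  have : 0 < Nat.size q.den := Nat.size_pos.mpr q.den_pos
  unfold bits
  omega

theorem size_mul_le (a b : ℕ) : Nat.size (a * b) ≤ Nat.size a + Nat.size b := by
  rw [Nat.size_le, pow_add]
  exact Nat.mul_lt_mul'' (Nat.lt_size_self a) (Nat.lt_size_self b)

theorem size_add_le (a b : ℕ) : Nat.size (a + b) ≤ Nat.size a + Nat.size b + 1 := by
  rw [Nat.size_le, pow_succ]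
  have h1 := (Nat.lt_size_self a).trans_le
    (Nat.pow_le_pow_right two_pos (Nat.le_add_right (Nat.size a) (Nat.size b)))
  have h2 := (Nat.lt_size_self b).trans_le
    (Nat.pow_le_pow_right two_pos (Nat.le_add_left (Nat.size b) (Nat.size a)))
  omega

theorem size_le_self (a : ℕ) : Nat.size a ≤ a :=
  Nat.size_le.mpr Nat.lt_two_pow_self

/-- Reduction to lowest terms can only shorten numerator and denominator. -/
theorem bits_divInt_le (a : ℤ) {b : ℤ} (hb : b ≠ 0) :
    bits (Rat.divInt a b) ≤ Nat.size a.natAbs + Nat.size b.natAbs := by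
  unfold bits
  refine add_le_add (Nat.size_le_size ?_) (Nat.size_le_size ?_)
  · rcases eq_or_ne a 0 with rfl | ha
    · simp
    · exact Int.natAbs_le_of_dvd_ne_zero (Rat.num_dvd a hb) ha
  · have := Int.natAbs_le_of_dvd_ne_zero (Rat.den_dvd a b) hb
    simpa using this

theorem bits_neg (q : ℚ) : bits (-q) = bits q := by
  simp [bits]

theorem bits_mul_le (p q : ℚ) : bits (p * q) ≤ bits p + bits q := by
  have h := bits_divInt_le (p.num * q.num) (b := ((p.den * q.den : ℕ) : ℤ))
    (by exact_mod_cast (Nat.mul_pos p.den_pos q.den_pos).ne')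
  have : p * q = Rat.divInt (p.num * q.num) ((p.den * q.den : ℕ) : ℤ) := by
    rw [Rat.divInt_eq_div]
    push_cast
    rw [mul_div_mul_comm, Rat.num_div_den, Rat.num_div_den]
  rw [← this, Int.natAbs_mul, Int.natAbs_natCast] at h
  have h1 := size_mul_le p.num.natAbs q.num.natAbs
  have h2 := size_mul_le p.den q.den
  unfold bits at *
  omega

theorem bits_add_le (p q : ℚ) : bits (p + q) ≤ 3 * (bits p + bits q) := by
  have h := bits_divInt_le (p.num * q.den + q.num * p.den) (b := ((p.den * q.den : ℕ) : ℤ))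
    (by exact_mod_cast (Nat.mul_pos p.den_pos q.den_pos).ne')
  have : p + q = Rat.divInt (p.num * q.den + q.num * p.den) ((p.den * q.den : ℕ) : ℤ) := by
    rw [Rat.divInt_eq_div]
    have hp : (p.den : ℚ) ≠ 0 := by exact_mod_cast p.den_pos.ne'
    have hq : (q.den : ℚ) ≠ 0 := by exact_mod_cast q.den_pos.ne'
    conv_lhs => rw [← Rat.num_div_den p, ← Rat.num_div_den q]
    push_cast
    field_simp
  rw [← this, Int.natAbs_natCast] at h
  have h0 : Nat.size (p.num * q.den + q.num * p.den).natAbs ≤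
      Nat.size (p.num.natAbs * q.den + q.num.natAbs * p.den) := by
    refine Nat.size_le_size ((Int.natAbs_add_le _ _).trans ?_)
    simp [Int.natAbs_mul]
  have h1 := size_add_le (p.num.natAbs * q.den) (q.num.natAbs * p.den)
  have h2 := size_mul_le p.num.natAbs q.den
  have h3 := size_mul_le q.num.natAbs p.den
  have h4 := size_mul_le p.den q.den
  have h5 := one_le_bits p
  unfold bits at *
  omega

theorem bits_sub_le (p q : ℚ) : bits (p - q) ≤ 3 * (bits p + bits q) := by
  rw [sub_eq_add_neg, ← bits_neg q]
  exact bits_add_le _ _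

theorem bits_div_le (p q : ℚ) : bits (p / q) ≤ bits p + bits q := by
  rw [div_eq_mul_inv]
  refine (bits_mul_le _ _).trans (Nat.add_le_add_left ?_ _)
  rcases eq_or_ne q 0 with rfl | hq
  · simp
  · rw [Rat.inv_def]
    refine (bits_divInt_le _ (Rat.num_ne_zero.mpr hq)).trans ?_
    simp [bits, add_comm]

theorem bits_zero : bits 0 = 1 := by
  have : bits 0 ≤ 0 + 1 := add_le_add (size_le_self 0) (size_le_self 1)
  exact le_antisymm this (one_le_bits 0)

theorem bits_one_le : bits 1 ≤ 2 :=
  add_le_add (size_le_self 1) (size_le_self 1)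

theorem bits_natCast_le (k : ℕ) : bits k ≤ k + 1 := by
  simpa [bits] using add_le_add (size_le_self k) (size_le_self 1)

/-! ### Running time

The bit lengths in each array are bounded by a fixed multiple `lvl a` of the input size, provided
the program respects these bounds in its assignments. -/

/-- A multiple of the input size that bounds the bit length of the value. -/
def Expr.coef (lvl : ℕ → ℕ) : Expr → ℕ
  | const q => q.num.natAbs + q.den
  | read a _ => lvl a
  | add e f => 3 * (e.coef lvl + f.coef lvl)
  | sub e f => 3 * (e.coef lvl + f.coef lvl)
  | mul e f => e.coef lvl + f.coef lvl
  | div e f => e.coef lvl + f.coef lvl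
  | le _ _ => 2

theorem Expr.bits_eval_le {lvl : ℕ → ℕ} {S : ℕ} (hS : 1 ≤ S) {m : Memory}
    (hm : ∀ a i, bits (m a i) ≤ lvl a * S) (e : Expr) : bits (e.eval m) ≤ e.coef lvl * S := by
  induction e with
  | const q =>
    refine (add_le_add (size_le_self _) (size_le_self _)).trans ?_
    exact Nat.le_mul_of_pos_right _ hS
  | read a e ih => exact hm _ _
  | add e f ihe ihf =>
    refine (bits_add_le _ _).trans ?_
    simp only [coef]
    linarith
  | sub e f ihe ihf =>
    refine (bits_sub_le _ _).trans ?_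
    simp only [coef]
    linarith
  | mul e f ihe ihf =>
    refine (bits_mul_le _ _).trans ?_
    simp only [coef]
    linarith
  | div e f ihe ihf =>
    refine (bits_div_le _ _).trans ?_
    simp only [coef]
    linarith
  | le e f ihe ihf =>
    have h1 := bits_one_le
    have h0 := bits_zero
    simp only [eval, coef]
    split_ifs <;> omega

theorem Expr.exists_cost_le (lvl : ℕ → ℕ) (e : Expr) :
    ∃ C : ℕ, ∀ (S : ℕ) (m : Memory), 1 ≤ S → (∀ a i, bits (m a i) ≤ lvl a * S) →
      e.cost m ≤ C * S := by
  have hnode : ∀ (e : Expr) (S : ℕ) (m : Memory), 1 ≤ S →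
      (∀ a i, bits (m a i) ≤ lvl a * S) → 1 + bits (e.eval m) ≤ (1 + e.coef lvl) * S := by
    intro e S m hS hm
    have := e.bits_eval_le hS hm
    linarith
  have hbin : ∀ e f g : Expr,
      (∃ C : ℕ, ∀ (S : ℕ) (m : Memory), 1 ≤ S → (∀ a i, bits (m a i) ≤ lvl a * S) →
        e.cost m ≤ C * S) →
      (∃ C : ℕ, ∀ (S : ℕ) (m : Memory), 1 ≤ S → (∀ a i, bits (m a i) ≤ lvl a * S) →
        f.cost m ≤ C * S) →
      (∀ m, g.cost m = e.cost m + f.cost m + 1 + bits (g.eval m)) →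
      ∃ C : ℕ, ∀ (S : ℕ) (m : Memory), 1 ≤ S → (∀ a i, bits (m a i) ≤ lvl a * S) →
        g.cost m ≤ C * S := by
    rintro e f g ⟨C, hC⟩ ⟨D, hD⟩ hg
    refine ⟨C + D + (1 + g.coef lvl), fun S m hS hm => ?_⟩
    have h1 := hC S m hS hm
    have h2 := hD S m hS hm
    have h3 := hnode g S m hS hm
    rw [hg]
    linarith
  induction e with
  | const q => exact ⟨_, hnode (const q)⟩
  | read a e ih =>
    obtain ⟨C, hC⟩ := ih
    refine ⟨C + (1 + (read a e).coef lvl), fun S m hS hm => ?_⟩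
    have h1 := hC S m hS hm
    have h2 := hnode (read a e) S m hS hm
    simp only [cost]
    linarith
  | add e f ihe ihf => exact hbin _ _ _ ihe ihf fun _ => rfl
  | sub e f ihe ihf => exact hbin _ _ _ ihe ihf fun _ => rfl
  | mul e f ihe ihf => exact hbin _ _ _ ihe ihf fun _ => rfl
  | div e f ihe ihf => exact hbin _ _ _ ihe ihf fun _ => rfl
  | le e f ihe ihf => exact hbin _ _ _ ihe ihf fun _ => rfl

/-- The number of agents. -/
def Expr.agents : Expr := read 0 (const 0)

/-- The assignments respect the bounds `lvl` on the bit lengths, the input is not overwritten, and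
all loops range over the agents. -/
def Program.Respects (lvl : ℕ → ℕ) : Program → Prop
  | skip => True
  | assign a _ e => a ≠ 0 ∧ e.coef lvl ≤ lvl a
  | seq P Q => P.Respects lvl ∧ Q.Respects lvl
  | ite _ P Q => P.Respects lvl ∧ Q.Respects lvl
  | loop x e P => x ≠ 0 ∧ 1 ≤ lvl x ∧ e = Expr.agents ∧ P.Respects lvl
  | valueQuery a _ => a ≠ 0 ∧ 1 ≤ lvl a
  | feasibleQuery a _ => a ≠ 0 ∧ 2 ≤ lvl a

structure Memory.IsBounded (lvl : ℕ → ℕ) (n S : ℕ) (m : Memory) : Prop where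
  agents : m 0 0 = n
  bits_le : ∀ a i, bits (m a i) ≤ lvl a * S

theorem Memory.IsBounded.write {lvl : ℕ → ℕ} {n S : ℕ} {m : Memory} (hm : m.IsBounded lvl n S)
    {a i : ℕ} {q : ℚ} (ha : a ≠ 0) (hq : bits q ≤ lvl a * S) :
    (m.write a i q).IsBounded lvl n S := by
  refine ⟨?_, fun a' i' => ?_⟩
  · simp [Memory.write, ha.symm, hm.agents]
  · unfold Memory.write
    split_ifs with h
    · rwa [h.1]
    · exact hm.bits_le a' i'

theorem Memory.IsBounded.floor_agents {lvl : ℕ → ℕ} {n S : ℕ} {m : Memory}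
    (hm : m.IsBounded lvl n S) : ⌊Expr.agents.eval m⌋₊ = n := by
  simp [Expr.agents, Expr.eval, hm.agents]

/-- The fold in `run` is over the range cast to rationals; here the cast is moved into the body. -/
theorem Program.run_loop {n : ℕ} (v : Finset (Fin n) → ℚ≥0) (feas : Finset (Fin n) → Bool)
    (x : ℕ) (e : Expr) (P : Program) (m : Memory) :
    (loop x e P).run v feas m =
      (List.range ⌊e.eval m⌋₊).foldl (fun r (k : ℕ) =>
        let r' := P.run v feas (r.1.write x 0 (k : ℚ))
        (r'.1, r.2 + 1 + bits (k : ℚ) + r'.2)) (m, 1 + e.cost m) := by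
  simp only [run, bind_pure_comp, List.map_eq_map, List.foldl_map]

/-- Under `Respects` the size bounds are invariant, so every expression costs linearly in `S`. Each
loop multiplies the time by at most `n ≤ S`, and the nesting depth is fixed by the program text. -/
theorem Program.exists_run_le {lvl : ℕ → ℕ} {P : Program} (hP : P.Respects lvl) :
    ∃ T : Polynomial ℕ, ∀ (n S : ℕ) (v : Finset (Fin n) → ℚ≥0) (feas : Finset (Fin n) → Bool)
      (m : Memory), n + 1 ≤ S → (∀ A, bits (v A) ≤ S) → m.IsBounded lvl n S →
      (P.run v feas m).1.IsBounded lvl n S ∧ (P.run v feas m).2 ≤ T.eval S := by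
  induction P with
  | skip => exact ⟨1, fun n S v feas m _ _ hm => ⟨hm, by simp [run]⟩⟩
  | assign a i e =>
    obtain ⟨C, hC⟩ := i.exists_cost_le lvl
    obtain ⟨D, hD⟩ := e.exists_cost_le lvl
    refine ⟨1 + Polynomial.C C * Polynomial.X + Polynomial.C D * Polynomial.X,
      fun n S v feas m hn _ hm => ⟨hm.write hP.1 ?_, ?_⟩⟩
    · exact (e.bits_eval_le (by omega) hm.bits_le).trans (Nat.mul_le_mul_right _ hP.2)
    · have h1 := hC S m (by omega) hm.bits_le
      have h2 := hD S m (by omega) hm.bits_le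
      simp only [run, Polynomial.eval_add, Polynomial.eval_mul, Polynomial.eval_C,
        Polynomial.eval_X, Polynomial.eval_one]
      omega
  | seq P Q ihP ihQ =>
    obtain ⟨T, hT⟩ := ihP hP.1
    obtain ⟨U, hU⟩ := ihQ hP.2
    refine ⟨1 + T + U, fun n S v feas m hn hv hm => ?_⟩
    have h1 := hT n S v feas m hn hv hm
    have h2 := hU n S v feas _ hn hv h1.1
    refine ⟨h2.1, ?_⟩
    simp only [run, Polynomial.eval_add, Polynomial.eval_one]
    omega
  | ite e P Q ihP ihQ =>
    obtain ⟨T, hT⟩ := ihP hP.1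
    obtain ⟨U, hU⟩ := ihQ hP.2
    obtain ⟨C, hC⟩ := e.exists_cost_le lvl
    refine ⟨1 + Polynomial.C C * Polynomial.X + T + U, fun n S v feas m hn hv hm => ?_⟩
    have h1 := hT n S v feas m hn hv hm
    have h2 := hU n S v feas m hn hv hm
    have h3 := hC S m (by omega) hm.bits_le
    simp only [run, Polynomial.eval_add, Polynomial.eval_mul, Polynomial.eval_C,
        Polynomial.eval_X, Polynomial.eval_one]
    split_ifs
    · exact ⟨h1.1, by omega⟩
    · exact ⟨h2.1, by omega⟩
  | loop x e P ih =>
    obtain ⟨hx, hl, rfl, hP⟩ := hP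
    obtain ⟨T, hT⟩ := ih hP
    obtain ⟨C, hC⟩ := Expr.agents.exists_cost_le lvl
    refine ⟨1 + Polynomial.C C * Polynomial.X +
      Polynomial.X * (1 + Polynomial.X + T), fun n S v feas m hn hv hm => ?_⟩
    have h0 := hC S m (by omega) hm.bits_le
    have key : ∀ k ≤ n,
        ((List.range k).foldl (fun r (k : ℕ) =>
          let r' := P.run v feas (r.1.write x 0 (k : ℚ))
          (r'.1, r.2 + 1 + bits (k : ℚ) + r'.2)) (m, 1 + Expr.agents.cost m)).1.IsBounded lvl n S ∧
        ((List.range k).foldl (fun r (k : ℕ) =>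
          let r' := P.run v feas (r.1.write x 0 (k : ℚ))
          (r'.1, r.2 + 1 + bits (k : ℚ) + r'.2)) (m, 1 + Expr.agents.cost m)).2 ≤
          1 + C * S + k * (1 + S + T.eval S) := by
      intro k
      induction k with
      | zero => exact fun _ => ⟨hm, by simpa using h0⟩
      | succ k ihk =>
        intro hk
        obtain ⟨h1, h2⟩ := ihk (by omega)
        rw [List.range_succ, List.foldl_append, List.foldl_cons, List.foldl_nil]
        have hb : bits (k : ℚ) ≤ S := (bits_natCast_le k).trans (by omega)
        have h3 := hT n S v feas _ hn hv
          (h1.write hx (i := 0) (hb.trans (Nat.le_mul_of_pos_left S hl)))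
        refine ⟨h3.1, ?_⟩
        simp only at h3 ⊢
        linarith [h3.2]
    have hk := key n le_rfl
    rw [run_loop, hm.floor_agents]
    refine ⟨hk.1, hk.2.trans ?_⟩
    simp only [Polynomial.eval_add, Polynomial.eval_mul, Polynomial.eval_C,
        Polynomial.eval_X, Polynomial.eval_one]
    have : n * (1 + S + T.eval S) ≤ S * (1 + S + T.eval S) := Nat.mul_le_mul_right _ (by omega)
    omega
  | valueQuery a s =>
    refine ⟨1 + Polynomial.X + Polynomial.X, fun n S v feas m hn hv hm => ⟨?_, ?_⟩⟩
    · exact hm.write hP.1 ((hv _).trans (Nat.le_mul_of_pos_left S hP.2))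
    · have := hv (decodeSet n m s)
      simp only [run, Polynomial.eval_add, Polynomial.eval_X, Polynomial.eval_one]
      omega
  | feasibleQuery a s =>
    refine ⟨2 + Polynomial.X, fun n S v feas m hn hv hm => ⟨?_, ?_⟩⟩
    · refine hm.write hP.1 ?_
      have h1 := bits_one_le
      have h0 := bits_zero
      have : 2 * 1 ≤ lvl a * S := Nat.mul_le_mul hP.2 (by omega)
      split_ifs <;> omega
    · simp only [run, Polynomial.eval_add, Polynomial.eval_X, Polynomial.eval_ofNat]
      omega

/-! ### The effect of programs on the memory -/

@[simp]
theorem Memory.write_self (m : Memory) (a i : ℕ) (q : ℚ) :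
    m.write a i q a = Function.update (m a) i q := by
  ext j
  simp [Memory.write, Function.update_apply]

@[simp]
theorem Memory.write_of_ne (m : Memory) {a a' : ℕ} (i : ℕ) (q : ℚ) (h : a' ≠ a) :
    m.write a i q a' = m a' := by
  ext j
  simp [Memory.write, h]

/-- Equality test. -/
def Expr.eq (e f : Expr) : Expr := mul (le e f) (le f e)

theorem Expr.eval_eq (m : Memory) (e f : Expr) :
    (e.eq f).eval m = if e.eval m = f.eval m then 1 else 0 := by
  simp only [Expr.eq, eval]
  rcases lt_trichotomy (e.eval m) (f.eval m) with h | h | h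
  · simp [h.le, not_le.mpr h, h.ne]
  · simp [h]
  · simp [h.le, not_le.mpr h, h.ne']

/-- Cell `0` of an array. -/
def Expr.cell (a : ℕ) : Expr := read a (const 0)

@[simp]
theorem Expr.eval_cell (m : Memory) (a : ℕ) : (cell a).eval m = m a 0 := by
  simp [cell, eval]

@[simp]
theorem Expr.eval_agents (m : Memory) : agents.eval m = m 0 0 := by
  simp [agents, eval]

namespace Program

/-- The program does not write into array `a`. -/
def Avoids (a : ℕ) : Program → Prop
  | skip => True
  | assign a' _ _ => a ≠ a'
  | seq P Q => P.Avoids a ∧ Q.Avoids a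
  | ite _ P Q => P.Avoids a ∧ Q.Avoids a
  | loop x _ P => a ≠ x ∧ P.Avoids a
  | valueQuery a' _ => a ≠ a'
  | feasibleQuery a' _ => a ≠ a'

section Semantics

variable {n : ℕ} (v : Finset (Fin n) → ℚ≥0) (feas : Finset (Fin n) → Bool)

/-- The memory after running a program. -/
def sem (P : Program) (m : Memory) : Memory := (P.run v feas m).1

variable {v feas}

theorem sem_skip (m : Memory) : skip.sem v feas m = m := rfl

theorem sem_assign (a : ℕ) (i e : Expr) (m : Memory) :
    (assign a i e).sem v feas m = m.write a ⌊i.eval m⌋₊ (e.eval m) := rfl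

theorem sem_seq (P Q : Program) (m : Memory) :
    (seq P Q).sem v feas m = Q.sem v feas (P.sem v feas m) := rfl

theorem sem_ite (e : Expr) (P Q : Program) (m : Memory) :
    (ite e P Q).sem v feas m = if e.eval m ≠ 0 then P.sem v feas m else Q.sem v feas m := by
  simp only [sem, run]
  split_ifs <;> rfl

theorem sem_valueQuery (a s : ℕ) (m : Memory) :
    (valueQuery a s).sem v feas m = m.write a 0 (v (decodeSet n m s)) := rfl

theorem sem_feasibleQuery (a s : ℕ) (m : Memory) :
    (feasibleQuery a s).sem v feas m =
      m.write a 0 (if feas (decodeSet n m s) then 1 else 0) := rfl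

theorem sem_loop (x : ℕ) (e : Expr) (P : Program) (m : Memory) :
    (loop x e P).sem v feas m =
      (List.range ⌊e.eval m⌋₊).foldl (fun m (k : ℕ) => P.sem v feas (m.write x 0 (k : ℚ))) m := by
  simp only [sem, run_loop]
  generalize 1 + e.cost m = t
  generalize List.range ⌊e.eval m⌋₊ = l
  induction l generalizing m t with
  | nil => rfl
  | cons k l ih => exact ih _ _

theorem sem_of_avoids {a : ℕ} {P : Program} (hP : P.Avoids a) (m : Memory) :
    P.sem v feas m a = m a := by
  induction P generalizing m with
  | skip => rfl
  | assign a' i e => exact Memory.write_of_ne _ _ _ hP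
  | seq P Q ihP ihQ => rw [sem_seq, ihQ hP.2, ihP hP.1]
  | ite e P Q ihP ihQ =>
    rw [sem_ite]
    split_ifs
    · exact ihP hP.1 m
    · exact ihQ hP.2 m
  | loop x e P ih =>
    rw [sem_loop]
    generalize List.range ⌊e.eval m⌋₊ = l
    induction l generalizing m with
    | nil => rfl
    | cons k l ihl =>
      rw [List.foldl_cons, ihl, ih hP.2, Memory.write_of_ne _ _ _ hP.1]
  | valueQuery a' s => exact Memory.write_of_ne _ _ _ hP
  | feasibleQuery a' s => exact Memory.write_of_ne _ _ _ hP

/-- The invariant rule for loops over the agents. -/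
theorem loop_induction {x : ℕ} {P : Program} {m : Memory} (hm : m 0 0 = n)
    (motive : ℕ → Memory → Prop) (zero : motive 0 m)
    (succ : ∀ k < n, ∀ m', (∀ a, (loop x Expr.agents P).Avoids a → m' a = m a) → motive k m' →
      motive (k + 1) (P.sem v feas (m'.write x 0 (k : ℚ)))) :
    motive n ((loop x Expr.agents P).sem v feas m) := by
  have hfloor : ⌊Expr.agents.eval m⌋₊ = n := by simp [hm]
  rw [sem_loop, hfloor]
  have key : ∀ k ≤ n,
      (∀ a, (loop x Expr.agents P).Avoids a → (List.range k).foldl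
        (fun m (k : ℕ) => P.sem v feas (m.write x 0 (k : ℚ))) m a = m a) ∧
      motive k ((List.range k).foldl (fun m (k : ℕ) => P.sem v feas (m.write x 0 (k : ℚ))) m) := by
    intro k
    induction k with
    | zero => exact fun _ => ⟨fun _ _ => rfl, zero⟩
    | succ k ih =>
      intro hk
      obtain ⟨h1, h2⟩ := ih (by omega)
      rw [List.range_succ, List.foldl_append, List.foldl_cons, List.foldl_nil]
      refine ⟨fun a ha => ?_, succ k (by omega) _ h1 h2⟩
      rw [sem_of_avoids ha.2, Memory.write_of_ne _ _ _ ha.1, h1 a ha]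
  exact (key n le_rfl).2

end Semantics

end Program

end Procurement
namespace Procurement

/-! ### The program

Arrays `5` and `6` hold the status and the gain of each agent, array `7` the values of the two
parts, and array `8` the bound `x`. The best offer is stored in arrays `16` to `19`. -/

namespace Program

open Procurement.Expr

/-- Store in array `20` the agents of part `j` and the candidate in array `24`. -/
def loadSet (j : ℕ) : Program :=
  loop 21 agents (assign 20 (cell 21)
    (add (eq (read 5 (cell 21)) (const j)) (eq (cell 21) (cell 24))))

def storeOffer (j : ℕ) : Program :=
  seq (assign 16 (const 0) (sub (cell 23) (read 7 (const j))))
    (seq (assign 17 (const 0) (cell 23))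
      (seq (assign 18 (const 0) (cell 24)) (assign 19 (const 0) (const j))))

/-- Compare the best offer with the one to let the candidate join part `j`. -/
def improveOffer (j : ℕ) : Program :=
  seq (loadSet j) (seq (feasibleQuery 22 20) (ite (cell 22)
    (seq (valueQuery 23 20)
      (ite (le (sub (cell 23) (read 7 (const j))) (cell 16)) skip (storeOffer j))) skip))

def clearOffer : Program :=
  seq (assign 16 (const 0) (const 0)) (seq (assign 17 (const 0) (const 0))
    (seq (assign 18 (const 0) (const 0)) (assign 19 (const 0) (const 0))))

def findOffer : Program :=
  seq clearOffer (loop 24 agents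
    (ite (read 5 (cell 24)) skip (seq (improveOffer 1) (improveOffer 2))))

def budget : Expr := read 0 (const 1)

def applyOffer : Program :=
  ite (le (cell 16) (const 0)) skip
    (seq (assign 6 (cell 18) (cell 16))
      (ite (mul (le (cell 17) (cell 8))
          (le (mul (read 1 (cell 18)) (cell 8)) (mul (cell 16) budget)))
        (seq (assign 5 (cell 18) (cell 19)) (assign 7 (cell 19) (cell 17)))
        (assign 5 (cell 18) (const 3))))

/-- Start with the affordable agents for which the expression `e`, which may refer to the agent in
array `25`, has value `1`. -/
def start (e : Expr) : Program :=
  seq (loop 25 agents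
    -- `3 - 3 * indicator` is `0` for an unprocessed agent and `3` for a discarded one.
    (seq (assign 5 (cell 25) (sub (const 3) (mul (const 3) (mul (le (read 1 (cell 25)) budget) e))))
      (assign 6 (cell 25) (const 0))))
    (seq (assign 7 (const 1) (const 0)) (assign 7 (const 2) (const 0)))

def runGreedy (e : Expr) : Program :=
  seq (start e) (loop 26 agents (seq findOffer applyOffer))

def raiseEstimate (j : ℕ) : Program :=
  ite (le (read 7 (const j)) (cell 28)) skip (assign 28 (const 0) (read 7 (const j)))

/-- The random bit of the agent in array `25`. -/
def inSide : Expr := read 2 (add (cell 25) (const 2))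

def notInSide : Expr := sub (const 1) inSide

/-- Array `29` keeps the best single gain and array `28` the running maximum. `runGreedy` leaves
both intact and resets its own state. -/
def computeEstimate : Program :=
  seq (start notInSide) (seq findOffer (seq (assign 29 (const 0) (cell 16))
    (seq (assign 28 (const 0) (cell 16)) (loop 27 agents
      (seq (assign 8 (const 0) (mul (cell 29) (add (cell 27) (const 1))))
        (seq (runGreedy notInSide) (seq (raiseEstimate 1) (raiseEstimate 2))))))))

/-- The second random bit selects the part: `1 + bit` is the index `J`. -/
def isWinner : Expr := eq (read 5 (cell 30)) (add (const 1) (read 2 (const 1)))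

def writeOutcome : Program :=
  loop 30 agents (seq (assign 3 (cell 30) isWinner)
    (assign 4 (cell 30) (mul isWinner (div (mul (read 6 (cell 30)) budget) (cell 8)))))

def greedyProgram : Program :=
  seq computeEstimate (seq (assign 8 (const 0) (div (cell 28) (const 16)))
    (seq (runGreedy inSide) writeOutcome))

/-- Only the winner's cells are written; all others rely on arrays `3` and `4` being zero initially.
-/
def soloProgram : Program :=
  seq (start (const 1)) (seq findOffer (ite (le (cell 16) (const 0)) skip
    (seq (assign 3 (cell 18) (const 1)) (assign 4 (cell 18) budget))))

def auction : Program := ite (read 2 (const 0)) greedyProgram soloProgram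

end Program

/-! ### Correctness of the program -/

section Correctness

open Program

variable {n : ℕ} {v : Finset (Fin n) → ℚ≥0} {feas : Finset (Fin n) → Bool}

structure Memory.HasOffer (m : Memory) (o : Offer) : Prop where
  gain : m 16 0 = o.gain
  value : m 17 0 = o.value
  agent : m 18 0 = o.agent
  part : m 19 0 = o.part

def Memory.HasStatus (m : Memory) (D : Fin n → ℕ) : Prop := ∀ z : Fin n, m 5 z = D z

theorem decodeSet_loadSet {D : Fin n → ℕ} {j i : ℕ} {m : Memory} (hn : m 0 0 = n)
    (hD : m.HasStatus D) (hi : m 24 0 = i) :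
    decodeSet n ((loadSet j).sem v feas m) 20 = joined D j i := by
  have key := loop_induction (v := v) (feas := feas) (x := 21)
    (P := Program.assign 20 (.cell 21)
      (.add (.eq (.read 5 (.cell 21)) (.const j)) (.eq (.cell 21) (.cell 24)))) hn
    (fun k m' => ∀ z : Fin n, (z : ℕ) < k →
      m' 20 z = (if D z = j then 1 else 0) + (if (z : ℕ) = i then 1 else 0))
    (fun z hz => absurd hz (Nat.not_lt_zero _)) ?_
  · ext z
    simp only [decodeSet, joined, mem_filter, mem_univ, true_and]
    unfold loadSet
    rw [key z z.2]
    split_ifs <;> simp_all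
  · intro k hk m' hfr hm' z hz
    have h5 : m' 5 = m 5 := hfr 5 (by simp [Avoids])
    have h24 : m' 24 = m 24 := hfr 24 (by simp [Avoids])
    rw [sem_assign]
    rcases Nat.lt_succ_iff_lt_or_eq.mp hz with hz | hz
    · have hne : (z : ℕ) ≠ k := hz.ne
      simp [hne, hm' z hz]
    · subst hz
      have := hD z
      simp [Expr.eval, Expr.eval_eq, h5, h24, this, hi]

theorem hasOffer_improveOffer {D : Fin n → ℕ} {j i : ℕ} {m : Memory} {o : Offer} (hi : i < n)
    (hn : m 0 0 = n) (hD : m.HasStatus D) (hm : m 24 0 = i) (hDi : D ⟨i, hi⟩ = 0)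
    (hv : m 7 j = v (part D j)) (ho : m.HasOffer o) :
    ((improveOffer j).sem v feas m).HasOffer (o.improve v feas D j i) := by
  have hdec := decodeSet_loadSet (v := v) (feas := feas) (j := j) hn hD hm
  have hfr : ∀ a, a ≠ 20 → a ≠ 21 → (loadSet j).sem v feas m a = m a := by
    intro a h1 h2
    exact sem_of_avoids (by simp [loadSet, Avoids, h1, h2]) m
  have hex : ∃ h : i < n, D ⟨i, h⟩ = 0 := ⟨hi, hDi⟩
  unfold improveOffer Offer.improve
  rw [sem_seq, sem_seq, sem_feasibleQuery, hdec, sem_ite]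
  generalize (loadSet j).sem v feas m = m₁ at *
  by_cases hf : feas (joined D j i)
  · have hdec' : decodeSet n (m₁.write 22 0 1) 20 = joined D j i := by
      rw [← hdec]; simp [decodeSet]
    simp only [hf, if_true, hex, true_and]
    rw [if_pos (by simp), sem_seq, sem_valueQuery, hdec', sem_ite]
    have hcond : ((Expr.le (.sub (.cell 23) (.read 7 (.const j))) (.cell 16)).eval
        ((m₁.write 22 0 1).write 23 0 (v (joined D j i))) ≠ 0) ↔
        ¬ o.gain < (v (joined D j i) : ℚ) - v (part D j) := by
      simp [Expr.eval, hfr, hv, ho.gain]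
    by_cases hg : o.gain < (v (joined D j i) : ℚ) - v (part D j)
    · rw [if_neg (by rw [hcond]; exact not_not.mpr hg), if_pos hg]
      constructor <;> simp [storeOffer, sem_seq, sem_assign, Expr.eval, hfr, hv, hm]
    · rw [if_pos (by rw [hcond]; exact hg), if_neg hg]
      constructor <;> simp [sem_skip, hfr, ho.gain, ho.value, ho.agent, ho.part]
  · simp only [hf]
    rw [if_neg (by simp)]
    constructor <;> simp [sem_skip, hfr, ho.gain, ho.value, ho.agent, ho.part]

theorem avoids_improveOffer {a : ℕ} (j : ℕ) (ha : a < 16 ∨ 23 < a) :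
    (improveOffer j).Avoids a := by
  simp only [improveOffer, loadSet, storeOffer, Avoids, and_true, true_and]
  omega

theorem avoids_findOffer {a : ℕ} (ha : a < 16 ∨ 24 < a) : findOffer.Avoids a := by
  have h1 := avoids_improveOffer (a := a) 1 (by omega)
  have h2 := avoids_improveOffer (a := a) 2 (by omega)
  simp only [findOffer, clearOffer, Avoids, h1, h2, and_true]
  omega

theorem hasOffer_findOffer {D : Fin n → ℕ} {m : Memory} (hn : m 0 0 = n) (hD : m.HasStatus D)
    (hv : ∀ j, j = 1 ∨ j = 2 → m 7 j = v (part D j)) :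
    (findOffer.sem v feas m).HasOffer (bestOffer v feas D n) := by
  have hfr : ∀ a, a < 16 → clearOffer.sem v feas m a = m a := by
    intro a ha
    refine sem_of_avoids ?_ m
    simp only [clearOffer, Avoids]
    omega
  have h0 : (clearOffer.sem v feas m).HasOffer ⟨0, 0, 0, 0⟩ := by
    constructor <;> simp [clearOffer, sem_seq, sem_assign, Expr.eval]
  unfold findOffer
  rw [sem_seq]
  generalize clearOffer.sem v feas m = m₁ at *
  refine loop_induction (v := v) (feas := feas) (by rw [hfr 0 (by omega), hn])
    (fun k m' => m'.HasOffer (bestOffer v feas D k)) h0 ?_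
  intro k hk m' hfr' ho
  have hlow : ∀ a, a < 16 → m' a = m a := by
    intro a ha
    rw [hfr' a, hfr a ha]
    have h1 := avoids_improveOffer (a := a) 1 (by omega)
    have h2 := avoids_improveOffer (a := a) 2 (by omega)
    simp only [Avoids, h1, h2, and_true]
    omega
  rw [sem_ite]
  have hDk := hD ⟨k, hk⟩
  simp only at hDk
  have ho' : (m'.write 24 0 k).HasOffer (bestOffer v feas D k) := by
    constructor <;> simp [ho.gain, ho.value, ho.agent, ho.part]
  by_cases hz : D ⟨k, hk⟩ = 0
  · rw [if_neg (by simp [Expr.eval, hlow, hDk, hz]), sem_seq]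
    have h1 := hasOffer_improveOffer (v := v) (feas := feas) (j := 1) (i := k)
      (m := m'.write 24 0 k) hk (by simp [hlow, hn])
      (D := D) (fun z => by simpa [hlow] using hD z) (by simp) hz
      (by simp [hlow, hv]) ho'
    have hfr₁ : ∀ a, a < 16 ∨ 23 < a →
        (improveOffer 1).sem v feas (m'.write 24 0 k) a = m'.write 24 0 k a :=
      fun a ha => sem_of_avoids (avoids_improveOffer 1 ha) _
    generalize (improveOffer 1).sem v feas (m'.write 24 0 k) = m₂ at *
    refine hasOffer_improveOffer (v := v) (feas := feas) (j := 2) (i := k) hk ?_ (D := D) ?_ ?_ hz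
      ?_ h1
    · simp [hfr₁, hlow, hn]
    · intro z
      simpa [hfr₁, hlow] using hD z
    · simp [hfr₁]
    · simp [hfr₁, hlow, hv]
  · rw [if_pos (by simp [Expr.eval, hlow, hDk, hz]), sem_skip]
    -- The program skips processed agents before any query, whereas `Offer.improve` tests the status
    -- itself.
    have hskip : ∀ j (o : Offer), o.improve v feas D j k = o := by
      intro j o
      unfold Offer.improve
      rw [if_neg]
      rintro ⟨⟨_, h⟩, _⟩
      exact hz h
    simpa only [bestOffer, hskip] using ho'

structure Memory.HasProgress (v : Finset (Fin n) → ℚ≥0) (m : Memory) (σ : Progress n) : Prop where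
  status : m.HasStatus σ.status
  gain : ∀ z : Fin n, m 6 z = σ.gain z
  value : ∀ j, j = 1 ∨ j = 2 → m 7 j = v (part σ.status j)

/-- The memory still holds the input. -/
structure Memory.HasInput (m : Memory) (B : ℚ) (c : Fin n → ℚ≥0) : Prop where
  agents : m 0 0 = n
  budget : m 0 1 = B
  cost : ∀ z : Fin n, m 1 z = c z

variable {B x : ℚ} {c : Fin n → ℚ≥0}

theorem Memory.HasInput.congr {m m' : Memory} (h : m.HasInput B c) (h0 : m' 0 = m 0)
    (h1 : m' 1 = m 1) : m'.HasInput B c :=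
  ⟨by rw [h0, h.agents], by rw [h0, h.budget], fun z => by rw [h1, h.cost]⟩

/-- Array `7` caches the values of the parts; on acceptance, the offer's value is the new value of
its part. -/
theorem hasProgress_step {m : Memory} {σ : Progress n} (hin : m.HasInput B c) (hx : m 8 0 = x)
    (hσ : m.HasProgress v σ) :
    ((Program.seq findOffer applyOffer).sem v feas m).HasProgress v (σ.step v feas B x c) := by
  rw [sem_seq]
  have ho := hasOffer_findOffer (v := v) (feas := feas) hin.agents hσ.status hσ.value
  have hfr : ∀ a, a < 16 → findOffer.sem v feas m a = m a :=
    fun a ha => sem_of_avoids (avoids_findOffer (.inl ha)) _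
  generalize findOffer.sem v feas m = m₁ at *
  have h16 := ho.gain
  have h17 := ho.value
  unfold applyOffer
  rw [sem_ite]
  rcases le_or_gt (bestOffer v feas σ.status n).gain 0 with hg | hg
  · rw [if_pos (by simp [Expr.eval, h16, hg]), Progress.step_of_gain_le hg, sem_skip]
    exact ⟨fun z => by rw [hfr 5 (by omega)]; exact hσ.status z,
      fun z => by rw [hfr 6 (by omega)]; exact hσ.gain z,
      fun j hj => by rw [hfr 7 (by omega)]; exact hσ.value j hj⟩
  · obtain ⟨i, hi⟩ := bestOffer_isSound _ _ hg
    rw [if_neg (by simp [Expr.eval, h16, not_le.mpr hg]), Progress.step_of_isSound hg hi, sem_seq,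
      sem_assign, sem_ite]
    have h18 : m₁ 18 0 = ((i : ℕ) : ℚ) := by rw [ho.agent, hi.agent_eq]
    have h19 := ho.part
    set o := bestOffer v feas σ.status n
    have hst : ∀ z : Fin n, m 5 z = σ.status z := hσ.status
    have hcond : ((Expr.mul (.le (.cell 17) (.cell 8))
        (.le (.mul (.read 1 (.cell 18)) (.cell 8)) (.mul (.cell 16) budget))).eval
          (m₁.write 6 ⌊(Expr.cell 18).eval m₁⌋₊ ((Expr.cell 16).eval m₁)) ≠ 0) ↔
        (o.value ≤ x ∧ (c i : ℚ) * x ≤ o.gain * B) := by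
      simp [Expr.eval, budget, h16, h17, h18, hfr, hx, hin.budget, hin.cost]
      exact and_comm
    have hother : ∀ s k, s ≠ k → (k = 1 ∨ k = 2) →
        part (Function.update σ.status i s) k = part σ.status k := by
      intro s k hsk hk
      refine part_update_of_ne ?_ hsk
      rw [hi.status_eq]
      omega
    by_cases hacc : o.value ≤ x ∧ (c i : ℚ) * x ≤ o.gain * B
    · rw [if_pos (hcond.mpr hacc), if_pos hacc]
      refine ⟨fun z => ?_, fun z => ?_, fun k hk => ?_⟩
      · rcases eq_or_ne z i with rfl | hne
        · simp [sem_seq, sem_assign, h18, h19]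
        · simp [sem_seq, sem_assign, h18, hfr, hne, hst, Fin.val_inj]
      · rcases eq_or_ne z i with rfl | hne
        · simp [sem_seq, sem_assign, h18, h16]
        · simp [sem_seq, sem_assign, h18, hfr, hne, hσ.gain, Fin.val_inj]
      · rcases eq_or_ne o.part k with rfl | hjk
        · simp [sem_seq, sem_assign, h18, h19, h17, part_update_self, hi.value_eq]
        · simp [sem_seq, sem_assign, h18, h19, hjk.symm, hother _ k hjk hk, hfr, hσ.value k hk]
    · rw [if_neg (fun h => hacc (hcond.mp h)), if_neg hacc]
      refine ⟨fun z => ?_, fun z => ?_, fun k hk => ?_⟩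
      · rcases eq_or_ne z i with rfl | hne
        · simp [sem_assign, h18, Expr.eval]
        · simp [sem_assign, h18, hfr, hne, hst, Fin.val_inj]
      · rcases eq_or_ne z i with rfl | hne
        · simp [sem_assign, h18, h16]
        · simp [sem_assign, h18, hfr, hne, hσ.gain, Fin.val_inj]
      · simp [sem_assign, h18, hother 3 k (by omega) hk, hfr, hσ.value k hk]

/-- The expression `e` indicates whether the agent in array `25` is in `side`. -/
def Memory.Indicates (m : Memory) (e : Expr) (side : Fin n → Bool) : Prop :=
  ∀ m' : Memory, m' 2 = m 2 → ∀ z : Fin n, m' 25 0 = ((z : ℕ) : ℚ) →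
    e.eval m' = if side z then 1 else 0

theorem Memory.Indicates.congr {m m' : Memory} {e : Expr} {side : Fin n → Bool}
    (h : m.Indicates e side) (h2 : m' 2 = m 2) : m'.Indicates e side :=
  fun m'' hm'' => h m'' (hm''.trans h2)

theorem avoids_start {a : ℕ} {e : Expr} (ha : a ≠ 5 ∧ a ≠ 6 ∧ a ≠ 7 ∧ a ≠ 25) :
    (start e).Avoids a := by
  simp only [start, Avoids]
  omega

theorem hasProgress_start {m : Memory} {e : Expr} {side : Fin n → Bool} (h0 : v ∅ = 0)
    (hin : m.HasInput B c) (he : m.Indicates e side) :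
    ((start e).sem v feas m).HasProgress v ⟨startStatus B c side, 0⟩ := by
  have key := loop_induction (v := v) (feas := feas) (x := 25)
    (P := Program.seq (.assign 5 (.cell 25)
        (.sub (.const 3) (.mul (.const 3) (.mul (.le (.read 1 (.cell 25)) budget) e))))
      (.assign 6 (.cell 25) (.const 0))) hin.agents
    (fun k m' => ∀ z : Fin n, (z : ℕ) < k → m' 5 z = startStatus B c side z ∧ m' 6 z = 0)
    (fun z hz => absurd hz (Nat.not_lt_zero _)) ?_
  · unfold start
    rw [sem_seq, sem_seq]
    refine ⟨fun z => ?_, fun z => ?_, fun j hj => ?_⟩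
    · simpa [sem_assign] using (key z z.2).1
    · simpa [sem_assign] using (key z z.2).2
    · rw [part_startStatus side hj, h0]
      rcases hj with rfl | rfl <;> simp [sem_assign, Expr.eval]
  · intro k hk m' hfr hm' z hz
    have hi := hin.congr (hfr 0 (by simp [Avoids])) (hfr 1 (by simp [Avoids]))
    rw [sem_seq, sem_assign, sem_assign]
    rcases Nat.lt_succ_iff_lt_or_eq.mp hz with hz | hz
    · have hne : (z : ℕ) ≠ k := hz.ne
      simpa [hne] using hm' z hz
    · subst hz
      have hez := he (m'.write 25 0 z) (by simpa using hfr 2 (by simp [Avoids])) z (by simp)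
      constructor
      · simp only [Expr.eval, budget, startStatus, hez]
        by_cases h1 : (c z : ℚ) ≤ B <;> by_cases h2 : side z <;> simp [hi.cost, hi.budget, h1, h2]
      · simp [Expr.eval]

theorem avoids_applyOffer {a : ℕ} (ha : a ≠ 5 ∧ a ≠ 6 ∧ a ≠ 7) : applyOffer.Avoids a := by
  simp only [applyOffer, Avoids, true_and]
  omega

theorem avoids_runGreedy {a : ℕ} {e : Expr} (ha : a < 5 ∨ (7 < a ∧ a < 16) ∨ 26 < a) :
    (runGreedy e).Avoids a := by
  have h1 := avoids_start (a := a) (e := e) (by omega)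
  have h2 := avoids_findOffer (a := a) (by omega)
  have h3 := avoids_applyOffer (a := a) (by omega)
  simp only [runGreedy, Avoids, h1, h2, h3, and_true, true_and]
  omega

theorem hasProgress_runGreedy {m : Memory} {e : Expr} {side : Fin n → Bool} (h0 : v ∅ = 0)
    (hin : m.HasInput B c) (hx : m 8 0 = x) (he : m.Indicates e side) :
    ((runGreedy e).sem v feas m).HasProgress v (greedy v feas B x c side) := by
  unfold runGreedy
  rw [sem_seq]
  have hs := hasProgress_start (v := v) (feas := feas) h0 hin he
  have hfr : ∀ a, a < 5 ∨ a = 8 → (start e).sem v feas m a = m a :=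
    fun a ha => sem_of_avoids (avoids_start (by omega)) _
  generalize (start e).sem v feas m = m₁ at *
  have hin₁ := hin.congr (hfr 0 (by omega)) (hfr 1 (by omega))
  refine loop_induction (v := v) (feas := feas) hin₁.agents
    (fun k m' => m'.HasProgress v (Progress.steps v feas B x c k ⟨startStatus B c side, 0⟩)) hs ?_
  intro k hk m' hfr' hm'
  have hav : ∀ a, a < 5 ∨ a = 8 → m' a = m₁ a := by
    intro a ha
    refine hfr' a ?_
    have h2 := avoids_findOffer (a := a) (by omega)
    have h3 := avoids_applyOffer (a := a) (by omega)
    simp only [Avoids, h2, h3, and_true]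
    omega
  rw [Progress.steps_succ]
  refine hasProgress_step (hin₁.congr ?_ ?_) ?_ ?_
  · simp [hav]
  · simp [hav]
  · simp [hav, hfr, hx]
  · refine ⟨fun z => ?_, fun z => ?_, fun j hj => ?_⟩
    · simpa using hm'.status z
    · simpa using hm'.gain z
    · simpa using hm'.value j hj

theorem sem_raiseEstimate {m : Memory} (j : ℕ) :
    (raiseEstimate j).sem v feas m 28 0 = max (m 28 0) (m 7 j) := by
  unfold raiseEstimate
  rw [sem_ite]
  rcases le_or_gt (m 7 j) (m 28 0) with h | h
  · rw [if_pos (by simp [Expr.eval, h]), sem_skip, max_eq_left h]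
  · rw [if_neg (by simp [Expr.eval, not_le.mpr h]), sem_assign, max_eq_right h.le]
    simp [Expr.eval]

theorem avoids_raiseEstimate {a : ℕ} (j : ℕ) (ha : a ≠ 28) : (raiseEstimate j).Avoids a := by
  simp only [raiseEstimate, Avoids, true_and]
  omega

theorem avoids_computeEstimate {a : ℕ} (ha : a < 5) : computeEstimate.Avoids a := by
  have h1 := avoids_start (a := a) (e := notInSide) (by omega)
  have h2 := avoids_findOffer (a := a) (by omega)
  have h3 := avoids_runGreedy (a := a) (e := notInSide) (by omega)
  simp only [computeEstimate, raiseEstimate, Avoids, h1, h2, h3, true_and]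
  omega

theorem sem_computeEstimate {m : Memory} {side : Fin n → Bool} (h0 : v ∅ = 0)
    (hin : m.HasInput B c) (he : m.Indicates notInSide side) :
    computeEstimate.sem v feas m 28 0 = estimate v feas B c side := by
  unfold computeEstimate
  rw [sem_seq, sem_seq, sem_seq, sem_seq, sem_assign, sem_assign]
  have hs := hasProgress_start (v := v) (feas := feas) h0 hin he
  have hfr : ∀ a, a < 5 → (start notInSide).sem v feas m a = m a :=
    fun a ha => sem_of_avoids (avoids_start (by omega)) _
  generalize (start notInSide).sem v feas m = m₁ at *
  have ho := hasOffer_findOffer (v := v) (feas := feas)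
    (by rw [hfr 0 (by omega), hin.agents]) hs.status hs.value
  have hfr₁ : ∀ a, a < 5 → findOffer.sem v feas m₁ a = m₁ a :=
    fun a ha => sem_of_avoids (avoids_findOffer (by omega)) _
  generalize findOffer.sem v feas m₁ = m₂ at *
  simp only at ho
  have hgain := ho.gain
  refine loop_induction (v := v) (feas := feas) (by simp [hfr₁, hfr, hin.agents])
    (fun k m' => m' 28 0 = estimateUpTo v feas B c side k) (by simp [Expr.eval, hgain,
      estimateUpTo]) ?_
  intro k hk m' hfr' hm'
  have hlow : ∀ a, a < 5 → m' a = m a := by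
    intro a ha
    have h3 := avoids_runGreedy (a := a) (e := notInSide) (by omega)
    have h4 := avoids_raiseEstimate (a := a) 1 (by omega)
    have h5 := avoids_raiseEstimate (a := a) 2 (by omega)
    rw [hfr' a (by simp only [Avoids, h3, h4, h5, and_true]; omega)]
    rw [Memory.write_of_ne _ _ _ (by omega), Memory.write_of_ne _ _ _ (by omega), hfr₁ a ha,
      hfr a ha]
  have h29 : m' 29 0 = (bestOffer v feas (startStatus B c side) n).gain := by
    have h3 := avoids_runGreedy (a := 29) (e := notInSide) (by omega)
    have h4 := avoids_raiseEstimate (a := 29) 1 (by omega)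
    have h5 := avoids_raiseEstimate (a := 29) 2 (by omega)
    rw [hfr' 29 (by simp [Avoids, h3, h4, h5])]
    simp [Expr.eval, hgain]
  rw [sem_seq, sem_seq, sem_seq, sem_assign, sem_raiseEstimate, sem_raiseEstimate]
  simp only [Expr.eval, Expr.eval_cell, Nat.floor_zero]
  set m₃ := (m'.write 27 0 (k : ℚ)).write 8 0
    ((m'.write 27 0 (k : ℚ)) 29 0 * ((m'.write 27 0 (k : ℚ)) 27 0 + 1)) with hm₃
  have hx : m₃ 8 0 = (bestOffer v feas (startStatus B c side) n).gain * (k + 1) := by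
    simp [hm₃, h29]
  have hg := hasProgress_runGreedy (v := v) (feas := feas) (m := m₃) h0
    (hin.congr (by simp [hm₃, hlow]) (by simp [hm₃, hlow])) hx
    (he.congr (by simp [hm₃, hlow]))
  have h28 : (runGreedy notInSide).sem v feas m₃ 28 0 = m' 28 0 := by
    rw [sem_of_avoids (avoids_runGreedy (by omega))]
    simp [hm₃]
  have h7 : (raiseEstimate 1).sem v feas ((runGreedy notInSide).sem v feas m₃) 7 =
      (runGreedy notInSide).sem v feas m₃ 7 := sem_of_avoids (avoids_raiseEstimate 1 (by omega)) _
  rw [h7, h28, hm', hg.value 1 (.inl rfl), hg.value 2 (.inr rfl)]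
  rfl

end Correctness

end Procurement
namespace Procurement

/-! ### The mechanism computed by the program -/

section Outcome

open Program

variable {n : ℕ} {v : Finset (Fin n) → ℚ≥0} {feas : Finset (Fin n) → Bool}
  {B x : ℚ} {c : Fin n → ℚ≥0}

theorem sem_writeOutcome {m : Memory} {σ : Progress n} {J : ℕ} (hin : m.HasInput B c)
    (hx : m 8 0 = x) (hσ : m.HasProgress v σ) (hJ : 1 + m 2 1 = J) :
    (∀ z : Fin n, writeOutcome.sem v feas m 3 z = if σ.status z = J then 1 else 0) ∧
    ∀ z : Fin n, writeOutcome.sem v feas m 4 z =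
      if σ.status z = J then σ.gain z * B / x else 0 := by
  have key := loop_induction (v := v) (feas := feas) (x := 30)
    (P := Program.seq (.assign 3 (.cell 30) isWinner)
      (.assign 4 (.cell 30)
        (.mul isWinner (.div (.mul (.read 6 (.cell 30)) budget) (.cell 8))))) hin.agents
    (fun k m' => ∀ z : Fin n, (z : ℕ) < k → m' 3 z = (if σ.status z = J then 1 else 0) ∧
      m' 4 z = if σ.status z = J then σ.gain z * B / x else 0)
    (fun z hz => absurd hz (Nat.not_lt_zero _)) ?_
  · exact ⟨fun z => (key z z.2).1, fun z => (key z z.2).2⟩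
  · intro k hk m' hfr hm' z hz
    have hlow : ∀ a, a < 3 ∨ (4 < a ∧ a < 30) → m' a = m a := by
      intro a ha
      refine hfr a ?_
      simp only [Avoids]
      omega
    rw [sem_seq, sem_assign, sem_assign]
    rcases Nat.lt_succ_iff_lt_or_eq.mp hz with hz | hz
    · have hne : (z : ℕ) ≠ k := hz.ne
      simpa [hne] using hm' z hz
    · subst hz
      have hst := hσ.status z
      constructor
      · simp [isWinner, Expr.eval_eq, Expr.eval, hlow, hst, hJ]
      · by_cases h : σ.status z = J <;>
          simp [isWinner, Expr.eval_eq, Expr.eval, hlow, hst, hJ, h, hσ.gain, budget, hin.budget,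
            hx]

theorem sem_greedyProgram {m : Memory} {side : Fin n → Bool} {J : ℕ} (h0 : v ∅ = 0)
    (hin : m.HasInput B c) (h1 : m.Indicates inSide side)
    (h2 : m.Indicates notInSide fun z => !side z) (hJ : 1 + m 2 1 = J) :
    decodeSet n (greedyProgram.sem v feas m) 3 = (greedyMechanism v feas B side J).select c ∧
    ∀ z : Fin n, greedyProgram.sem v feas m 4 z = (greedyMechanism v feas B side J).pay c z := by
  unfold greedyProgram
  rw [sem_seq, sem_seq, sem_seq, sem_assign]
  have he := sem_computeEstimate (v := v) (feas := feas) h0 hin h2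
  have hfr : ∀ a, a < 5 → computeEstimate.sem v feas m a = m a :=
    fun a ha => sem_of_avoids (avoids_computeEstimate ha) _
  generalize computeEstimate.sem v feas m = m₁ at *
  simp only [Expr.eval, Expr.eval_cell, he, Nat.floor_zero]
  set x := estimate v feas B c (fun z => !side z) / 16 with hx
  have hσ := hasProgress_runGreedy (v := v) (feas := feas) (m := m₁.write 8 0 x) (x := x) h0
    (hin.congr (by simp [hfr]) (by simp [hfr])) (by simp) (h1.congr (by simp [hfr]))
  have hfr' : ∀ a, a < 5 ∨ a = 8 → (runGreedy inSide).sem v feas (m₁.write 8 0 x) a =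
      m₁.write 8 0 x a := fun a ha => sem_of_avoids (avoids_runGreedy (by omega)) _
  generalize (runGreedy inSide).sem v feas (m₁.write 8 0 x) = m₂ at *
  obtain ⟨hs, hp⟩ := sem_writeOutcome (v := v) (feas := feas) (J := J) (m := m₂) (x := x)
    (hin.congr (by simp [hfr, hfr']) (by simp [hfr, hfr'])) (by simp [hfr']) hσ
    (by simp [hfr, hfr', hJ])
  constructor
  · ext z
    simp [decodeSet, hs, greedyMechanism, mem_part, ← hx]
  · intro z
    rw [hp]
    rfl

theorem sem_soloProgram {m : Memory} (h0 : v ∅ = 0) (hin : m.HasInput B c) (h3 : m 3 = 0)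
    (h4 : m 4 = 0) :
    decodeSet n (soloProgram.sem v feas m) 3 = (soloMechanism v feas B).select c ∧
    ∀ z : Fin n, soloProgram.sem v feas m 4 z = (soloMechanism v feas B).pay c z := by
  unfold soloProgram
  rw [sem_seq, sem_seq, sem_ite]
  have hs := hasProgress_start (v := v) (feas := feas) (e := .const 1) (side := fun _ => true) h0
    hin (fun _ _ _ _ => by simp [Expr.eval])
  have hfr : ∀ a, a < 5 → (start (.const 1)).sem v feas m a = m a :=
    fun a ha => sem_of_avoids (avoids_start (by omega)) _
  generalize (start (.const 1)).sem v feas m = m₁ at *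
  have ho := hasOffer_findOffer (v := v) (feas := feas)
    (by rw [hfr 0 (by omega), hin.agents]) hs.status hs.value
  have hfr₁ : ∀ a, a < 5 → findOffer.sem v feas m₁ a = m₁ a :=
    fun a ha => sem_of_avoids (avoids_findOffer (by omega)) _
  generalize findOffer.sem v feas m₁ = m₂ at *
  simp only at ho
  have h16 := ho.gain
  have h18 := ho.agent
  simp only [soloMechanism]
  set o := bestOffer v feas (startStatus B c fun _ => true) n
  by_cases hg : o.gain ≤ 0
  · rw [if_pos (by simp [Expr.eval, h16, hg]), sem_skip]
    simp [hg, decodeSet, hfr₁, hfr, h3, h4]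
  · rw [if_neg (by simp [Expr.eval, h16, hg]), sem_seq, sem_assign, sem_assign]
    simp only [hg, if_false]
    constructor
    · ext z
      simp [decodeSet, h18, hfr₁, hfr, h3, Expr.eval, Function.update_apply]
    · intro z
      simp [h18, hfr₁, hfr, h4, Expr.eval, Function.update_apply, budget, hin.budget]

end Outcome

open Classical in
-- Bit `0` chooses the mechanism, bit `1` the part that is bought, and the remaining `n` bits the
-- split.
theorem mechanism_auction {n : ℕ} (K : Market n) (ω : Fin (n + 2) → Bool) :
    Program.auction.mechanism K ω =
      if ω 0 then
        greedyMechanism K.value (fun S => decide (S ∈ K.feasible)) K.budget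
          (fun z => ω z.succ.succ) (if ω 1 then 2 else 1)
      else soloMechanism K.value (fun S => decide (S ∈ K.feasible)) K.budget := by
  have hcost : ∀ b : Fin n → ℚ≥0, (inputMemory K.budget b ω).HasInput (K.budget : ℚ) b :=
    fun b => ⟨by simp [inputMemory], by simp [inputMemory], fun z => by simp [inputMemory]⟩
  have hbit : ∀ (b : Fin n → ℚ≥0) (z : Fin n), inputMemory K.budget b ω 2 (z + 2) =
      if ω z.succ.succ then 1 else 0 := by
    intro b z
    simp only [inputMemory]
    simp [Fin.succ, Nat.add_assoc]
  have hside : ∀ b : Fin n → ℚ≥0,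
      (inputMemory K.budget b ω).Indicates Program.inSide fun z => ω z.succ.succ := by
    intro b m' hm' z hz
    have : ⌊((z : ℕ) : ℚ) + 2⌋₊ = (z : ℕ) + 2 := by
      exact_mod_cast Nat.floor_natCast (R := ℚ) ((z : ℕ) + 2)
    simp only [Program.inSide, Expr.eval, Expr.eval_cell, hz, this, hm', hbit]
  have hside' : ∀ b : Fin n → ℚ≥0,
      (inputMemory K.budget b ω).Indicates Program.notInSide fun z => !ω z.succ.succ := by
    intro b m' hm' z hz
    have := hside b m' hm' z hz
    simp only [Program.notInSide, Expr.eval, this]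
    by_cases h : ω z.succ.succ = true <;> simp [h]
  have hω0 : ∀ b : Fin n → ℚ≥0, inputMemory K.budget b ω 2 0 = if ω 0 then 1 else 0 := by
    intro b
    simp [inputMemory]
    rfl
  have hω1 : ∀ b : Fin n → ℚ≥0, inputMemory K.budget b ω 2 1 = if ω 1 then 1 else 0 := by
    intro b
    simp [inputMemory]
    rfl
  have hexec : ∀ b, (Program.auction.execute K b ω).1 =
      if ω 0 then Program.greedyProgram.sem K.value (fun S => decide (S ∈ K.feasible))
        (inputMemory K.budget b ω)
      else Program.soloProgram.sem K.value (fun S => decide (S ∈ K.feasible))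
        (inputMemory K.budget b ω) := by
    intro b
    change Program.auction.sem _ _ _ = _
    rw [Program.auction, Program.sem_ite]
    simp [Expr.eval, hω0]
  cases h0 : ω 0
  · have hs := fun b => sem_soloProgram (v := K.value) (feas := fun S => decide (S ∈ K.feasible))
      K.value_empty (hcost b) (by ext; simp [inputMemory]) (by ext; simp [inputMemory])
    simp only [h0] at hexec
    simp only [Program.mechanism, hexec, Bool.false_eq_true, if_false, hs]
  · have hs := fun b => sem_greedyProgram (v := K.value)
      (feas := fun S => decide (S ∈ K.feasible)) (J := if ω 1 then 2 else 1)
      K.value_empty (hcost b) (hside b) (hside' b) (by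
        rw [hω1]
        split_ifs <;> norm_num)
    simp only [h0] at hexec
    simp only [Program.mechanism, hexec, if_true, hs]

/-! ### Running time of the program -/

namespace Program

/-- Such constants exist because no array accumulates: sizes only flow from inputs and oracle
answers through boundedly many operations. For instance, array `8` receives array `28` divided by
`16`, hence `6 + 17`. -/
def auctionLevel : ℕ → ℕ
  | 2 => 2
  | 3 => 4
  | 4 => 34
  | 5 => 66
  | 6 => 6
  | 8 => 23
  | 16 => 6
  | 19 => 3
  | 20 => 24
  | 22 => 2
  | 28 => 6
  | 29 => 6
  | _ => 1

theorem respects_auction : auction.Respects auctionLevel := by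
  simp [auction, greedyProgram, soloProgram, computeEstimate, writeOutcome, runGreedy, start,
    findOffer, applyOffer, clearOffer, improveOffer, storeOffer, loadSet, raiseEstimate, isWinner,
    inSide, notInSide, budget, Respects, Expr.coef, Expr.eq, Expr.cell, auctionLevel]

theorem exists_execute_le : ∃ T : Polynomial ℕ, ∀ (n r : ℕ) (K : Market n) (b : Fin n → ℚ≥0)
    (ω : Fin r → Bool), (auction.execute K b ω).2 ≤ T.eval (K.size b) := by
  obtain ⟨T, hT⟩ := exists_run_le respects_auction
  -- The shift by one provides `n + 1 ≤ S`, needed for the bit length of loop counters.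
  refine ⟨T.comp (Polynomial.X + 1), fun n r K b ω => ?_⟩
  rw [Polynomial.eval_comp, Polynomial.eval_add, Polynomial.eval_X, Polynomial.eval_one]
  refine (hT n (K.size b + 1) _ _ _ ?_ (fun A => ?_) ⟨by simp [inputMemory], fun a i => ?_⟩).2
  · unfold Market.size
    omega
  · have : bits (K.value A) ≤ univ.sup fun S : Finset (Fin n) => bits (K.value S) :=
      le_sup (f := fun S : Finset (Fin n) => bits (K.value S)) (mem_univ A)
    unfold Market.size
    omega
  · have hz := bits_zero
    have ho := bits_one_le
    have hlvl : ∀ a, 1 ≤ auctionLevel a := by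
      intro a
      unfold auctionLevel
      split <;> omega
    have hpos : 1 ≤ auctionLevel a * (K.size b + 1) :=
      Nat.mul_pos (hlvl a) (Nat.succ_pos _)
    unfold inputMemory
    split_ifs with h1 h2 h3 h4 h5 h6 h7 h8
    · refine (bits_natCast_le n).trans (le_trans ?_ (Nat.le_mul_of_pos_left _ (hlvl a)))
      unfold Market.size
      omega
    · refine le_trans ?_ (Nat.le_mul_of_pos_left _ (hlvl a))
      unfold Market.size
      omega
    · omega
    · refine le_trans ?_ (Nat.le_mul_of_pos_left _ (hlvl a))
      have := single_le_sum (f := fun i => bits (b i)) (fun _ _ => Nat.zero_le _)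
        (mem_univ (⟨i, h5⟩ : Fin n))
      unfold Market.size
      omega
    · omega
    · subst h6
      simp only [auctionLevel]
      omega
    · omega
    · omega
    · omega

end Program

/-! ### The approximation guarantee -/

theorem sum_bits_eq {n : ℕ} (f : (Fin (n + 2) → Bool) → ℚ) :
    ∑ ω, f ω = ∑ s : Fin n → Bool,
      (f (Fin.cons false (Fin.cons false s)) + f (Fin.cons false (Fin.cons true s)) +
        (f (Fin.cons true (Fin.cons false s)) + f (Fin.cons true (Fin.cons true s)))) := by
  have hstep : ∀ (k : ℕ) (g : (Fin (k + 1) → Bool) → ℚ),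
      ∑ ω, g ω = ∑ s : Fin k → Bool, (g (Fin.cons false s) + g (Fin.cons true s)) := by
    intro k g
    rw [← (Fin.consEquiv fun _ : Fin (k + 1) => Bool).sum_comp g, Fintype.sum_prod_type,
      Fintype.sum_bool, ← sum_add_distrib]
    exact sum_congr rfl fun s _ => add_comm _ _
  rw [hstep (n + 1) f, hstep n]
  exact sum_congr rfl fun s _ => by ring

open Classical in
-- If a single agent has more than `1 / 2048` of the optimum, the solo mechanism suffices; otherwise
-- the greedy one does. There are `4 * 2 ^ n` outcomes of the bits, so the constant is `4 * 4096`.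
theorem opt_le_auction {n : ℕ} (K : Market n)
    (hI : IsTwoSystem fun S => decide (S ∈ K.feasible)) (c : Fin n → ℚ≥0) :
    K.opt c ≤ ((16384 : ℕ) : ℚ≥0) *
      𝔼 ω : Fin (n + 2) → Bool, K.value ((Program.auction.mechanism K ω).select c) := by
  have hB : (0 : ℚ) < K.budget := by exact_mod_cast K.budget_pos
  obtain ⟨O, hO, hopt⟩ := exists_mem_eq_sup
    (univ.filter fun S : Finset (Fin n) => S ∈ K.feasible ∧ ∑ i ∈ S, c i ≤ K.budget)
    ⟨∅, by simpa using hI.empty⟩ K.value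
  obtain ⟨-, hfO, hcO⟩ := mem_filter.mp hO
  have hcO' : ∑ i ∈ O, (c i : ℚ) ≤ K.budget := by exact_mod_cast hcO
  have hV : ∀ S, decide (S ∈ K.feasible) → ∑ i ∈ S, (c i : ℚ) ≤ K.budget →
      (K.value S : ℚ) ≤ K.value O := by
    intro S hS hcS
    have : K.value S ≤ K.value O := by
      rw [← hopt]
      refine le_sup (mem_filter.mpr ⟨mem_univ _, by simpa using hS, ?_⟩)
      exact_mod_cast hcS
    exact_mod_cast this
  have hoptO : K.opt c = K.value O := hopt
  rw [hoptO, Fintype.expect_eq_sum_div_card, ← NNRat.cast_le (K := ℚ)]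
  push_cast
  rw [sum_bits_eq]
  simp only [mechanism_auction, Fin.cons_zero, Fin.cons_one, Fin.cons_succ, if_true,
    Bool.false_eq_true, if_false, Fintype.card_fun, Fintype.card_bool, Fintype.card_fin,
    Nat.cast_pow, Nat.cast_ofNat, sum_add_distrib, sum_const, card_univ, nsmul_eq_mul]
  set u := (K.value ((soloMechanism K.value (fun S => decide (S ∈ K.feasible))
    (K.budget : ℚ)).select c) : ℚ) with hu
  have hsolo := le_value_soloMechanism (v := K.value) (feas := fun S => decide (S ∈ K.feasible))
    (B := (K.budget : ℚ)) K.value_empty c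
  rw [← hu] at hsolo
  have hgreedy := sum_value_greedyMechanism (c := c) K.submodular K.value_empty hI hB
    (by simpa using hfO) hcO' hV
  rw [sum_add_distrib] at hgreedy
  set G₁ := ∑ side : Fin n → Bool, (K.value ((greedyMechanism K.value
    (fun S => decide (S ∈ K.feasible)) (K.budget : ℚ) side 1).select c) : ℚ)
  set G₂ := ∑ side : Fin n → Bool, (K.value ((greedyMechanism K.value
    (fun S => decide (S ∈ K.feasible)) (K.budget : ℚ) side 2).select c) : ℚ)
  have hG₁ : 0 ≤ G₁ := sum_nonneg fun _ _ => NNRat.cast_nonneg _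
  have hG₂ : 0 ≤ G₂ := sum_nonneg fun _ _ => NNRat.cast_nonneg _
  have hu0 : 0 ≤ u := NNRat.cast_nonneg _
  have hpow : (0 : ℚ) < 2 ^ n := by positivity
  have hmain : (2 : ℚ) ^ n * K.value O ≤
      4096 * (2 ^ n * u + 2 ^ n * u + (G₁ + G₂)) := by
    rcases le_or_gt (2048 * (bestOffer K.value (fun S => decide (S ∈ K.feasible))
      (startStatus (K.budget : ℚ) c fun _ => true) n).gain) (K.value O : ℚ) with h | h
    · have h1 := hgreedy h
      have h2 : 0 ≤ (2 : ℚ) ^ n * u := by positivity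
      linarith
    · have h1 : (K.value O : ℚ) ≤ 2048 * u := by linarith
      have h2 := mul_le_mul_of_nonneg_left h1 hpow.le
      have h3 : 0 ≤ (2 : ℚ) ^ n * u := by positivity
      linarith
  rw [mul_div_assoc', le_div_iff₀ (by positivity), pow_add]
  linarith

end Procurement

/-! ### The main theorem -/

open Procurement
theorem mainTheorem7 :
    ∃ (P : Program) (r T : Polynomial ℕ) (α : ℕ),
      ∀ (n : ℕ) (K : Market n),
        (IsCardinalityConstraint K.feasible ∨ IsMatroidConstraint K.feasible ∨
          IsMatchingConstraint K.feasible) →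
        -- for every outcome of the random bits, a deterministic mechanism with all the properties
        (∀ ω : Fin (r.eval n) → Bool,
          (P.mechanism K ω).IsTruthful ∧
          (P.mechanism K ω).IsIndividuallyRational ∧
          (P.mechanism K ω).PaysOnlySelected ∧
          (P.mechanism K ω).IsBudgetFeasible K.budget ∧
          (∀ b : Fin n → ℚ≥0, (P.mechanism K ω).select b ∈ K.feasible) ∧
          (∀ b : Fin n → ℚ≥0, (P.execute K b ω).2 ≤ T.eval (K.size b))) ∧
        -- approximation in expectation over uniformly random bits
        (∀ c : Fin n → ℚ≥0,
          K.opt c ≤ (α : ℚ≥0) * 𝔼 ω : Fin (r.eval n) → Bool, K.value ((P.mechanism K ω).select c)) := by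
  classical
  obtain ⟨T, hT⟩ := Program.exists_execute_le
  refine ⟨Program.auction, Polynomial.X + 2, T, 16384, fun n K hK => ?_⟩
  have hI := isTwoSystem_of_constraint hK
  have hr : (Polynomial.X + 2 : Polynomial ℕ).eval n = n + 2 := by simp
  -- The evaluated polynomial occurs in the type of `ω`; it is generalized so that it can be
  -- replaced by `n + 2`.
  generalize (Polynomial.X + 2 : Polynomial ℕ).eval n = N at hr ⊢
  subst hr
  refine ⟨fun ω => ?_, opt_le_auction K hI⟩
  have key : (Program.auction.mechanism K ω).IsThresholdPriced ∧
      (Program.auction.mechanism K ω).IsBudgetFeasible K.budget ∧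
      ∀ b : Fin n → ℚ≥0, (Program.auction.mechanism K ω).select b ∈ K.feasible := by
    rw [mechanism_auction]
    obtain ⟨J, hJω, hJ⟩ : ∃ J, (if ω 1 then 2 else 1) = J ∧ (J = 1 ∨ J = 2) :=
      ⟨_, rfl, by split_ifs <;> simp⟩
    rw [hJω]
    by_cases h : ω 0 = true
    · rw [if_pos h]
      exact ⟨greedyMechanism_isThresholdPriced (NNRat.cast_nonneg _) _ hJ,
        greedyMechanism_isBudgetFeasible hI.empty K.value_empty _ hJ, fun b => by
          simpa using greedyMechanism_feasible (feas := fun S => decide (S ∈ K.feasible))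
            (B := (K.budget : ℚ)) hI.empty K.value_empty
            (fun z => ω z.succ.succ) hJ b⟩
    · rw [if_neg h]
      exact ⟨soloMechanism_isThresholdPriced, soloMechanism_isBudgetFeasible, fun b => by
        simpa using soloMechanism_feasible (v := K.value)
          (feas := fun S => decide (S ∈ K.feasible)) (B := (K.budget : ℚ)) hI.empty b⟩
  exact ⟨key.1.isTruthful, key.1.isIndividuallyRational, key.1.paysOnlySelected, key.2.1, key.2.2,
    fun b => hT n _ K b ω⟩
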